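/- **Setting.** Let $d\ge 1$. A tile is a pair $T=(A,i)$ with $A=\mathrm{supp}(T)\subset\mathbb R^d$ non-empty, compact and the closure of its interior, and $i\in\{1,\dots,m\}$ its type; $T+y=(A+y,i)$. A patch is a finite set of tiles with pairwise disjoint interiors. Let $\omega$ be a tile-substitution with prototiles $T_j=(A_j,j)$, $j\le m$, and expansion $\phi$: $\phi:\mathbb R^d\to\mathbb R^d$ is linear with $|\phi(x)|=\lambda|x|$ for all $x$, for some $\lambda>1$, and $\omega(T_j)$ is a patch of translates of prototiles with support $\phi A_j$. Put $\omega(T_j+y)=\omega(T_j)+\phi y$ and $\omega(P)=\bigcup_{T\in P}\omega(T)$. Let $\mathsf S$ be the $m\times m$ matrix whose entry $\mathsf S_{ij}$ is the number of tiles of type $i$ in $\omega(T_j)$, and let $X_\omega$ be the set of tilings $\mathcal T$ of $\mathbb R^d$ (tiles covering $\mathbb R^d$, with pairwise disjoint interiors) each of whose finite patches is a translate of a subpatch of some $\omega^n(T_j)$. Assume that $\omega$ is primitive (some $\mathsf S^k$, $k\ge1$, is entrywise positive), has finite local complexity (for each $r>0$ there are, up to translation, only finitely many subpatches of the $\omega^n(T_j)$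 of diameter less than $r$) and is non-periodic ($\mathcal T-y=\mathcal T\in X_\omega$ implies $y=0$). Let $E^{++}\subset\mathbb C^m$ be the span of the Jordan cells (the sum of the generalized eigenspaces) of $\mathsf S^t$ for the eigenvalues with $|\theta|>\lambda^{d-1}$; $\mathsf S^t$ is invertible on it. For $\mathcal T\in X_\omega$ and $k\le 0$ let $\mathcal T^{(k)}$ be the sub-tiling obtained from $\mathcal T^{(0)}=\mathcal T$ by subdividing $|k|$ times, where a tile $\phi^{k}(T_j)+y$ of order $k$ is replaced by the tiles $\phi^{k-1}(T)+y$, $T\in\omega(T_j)$, of order $k-1$. For $v\in E^{++}$ and bounded open $\Omega\subset\mathbb R^d$ define $$\Phi^+_{v,\mathcal T}(\Omega)=\lim_{k\to-\infty}\ \sum_{\substack{T\in\mathcal T^{(k)}\\ \mathrm{supp}(T)\subset\Omega}}\bigl((\mathsf S^t)^k v\bigr)_{\ell(T)},\qquad \ell(T)=\text{the type of }T,$$ whenever the limit exists. A Lipschitz domain is a bounded open set $\Omega\subset\mathbb R^d$ such that $\partial\Omega\subset\bigcup_{i\le N}h_i([0,1]^{d-1})$ for finitely many Lipschitz maps $h_i:\mathbb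 R^{d-1}\to\mathbb R^d$. **Lemma.** For every Lipschitz domain $\Omega$ there is a constant $C=C(\omega,\Omega)>0$ such that the following holds. Let $v\in E^{++}$, $\|v\|=1$ (Euclidean norm), belong to the $\mathsf S^t$-invariant subspace corresponding to a Jordan block of $\mathsf S^t$ of size $s\ge1$ with eigenvalue $\theta$. Then for all $\mathcal T\in X_\omega$ and all $R\ge2$ the limit defining $\Phi^+_{v,\mathcal T}(R\Omega)$ exists and $$|\Phi^+_{v,\mathcal T}(R\Omega)|\le C\,(\log R)^{s-1}R^{\alpha},\qquad \alpha=\frac{\log|\theta|}{\log\lambda}.$$ -/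

import Mathlib

open Filter Topology
open scoped Pointwise

noncomputable section

/-! ### Linear algebra -/

section LinearAlgebra

variable {V : Type*} [AddCommGroup V] [Module ℂ V]

/-- The sum of the generalized eigenspaces of `f` (equivalently, the span of its Jordan cells)
over all eigenvalues of absolute value larger than `c`. -/
def rapidSubspace (f : Module.End ℂ V) (c : ℝ) : Submodule ℂ V :=
  ⨆ θ : ℂ, ⨆ _ : c < ‖θ‖, f.maxGenEigenspace θ

lemma rapidSubspace_mapsTo (f : Module.End ℂ V) (c : ℝ) :
    ∀ x ∈ rapidSubspace f c, f x ∈ rapidSubspace f c := by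
  have h : rapidSubspace f c ≤ (rapidSubspace f c).comap f := by
    refine iSup₂_le fun θ hθ x hx => ?_
    have h1 : f x ∈ f.maxGenEigenspace θ :=
      f.mapsTo_maxGenEigenspace_of_comm (Commute.refl f) θ hx
    exact (le_iSup₂ (f := fun (θ : ℂ) (_ : c < ‖θ‖) => f.maxGenEigenspace θ) θ hθ) h1
  exact h

lemma rapidSubspace_bijective [FiniteDimensional ℂ V] (f : Module.End ℂ V) {c : ℝ} (hc : 0 ≤ c) :
    Function.Bijective (f.restrict (rapidSubspace_mapsTo f c)) := by
  have hinj : Function.Injective (f.restrict (rapidSubspace_mapsTo f c)) := by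
    rw [← LinearMap.ker_eq_bot, LinearMap.ker_eq_bot']
    rintro ⟨x, hx⟩ h0
    have hfx : f x = 0 := congrArg Subtype.val h0
    have hx0 : x ∈ f.maxGenEigenspace 0 := by
      rw [Module.End.mem_maxGenEigenspace]
      exact ⟨1, by simpa using hfx⟩
    have hle : rapidSubspace f c ≤ ⨆ θ : ℂ, ⨆ _ : θ ≠ 0, f.maxGenEigenspace θ := by
      refine iSup₂_le fun θ hθ => ?_
      have hne : θ ≠ 0 := by
        rintro rfl
        simp at hθ
        linarith
      exact le_iSup₂ (f := fun (θ : ℂ) (_ : θ ≠ 0) => f.maxGenEigenspace θ) θ hne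
    have hdis := f.independent_maxGenEigenspace 0
    have : x = 0 := (Submodule.disjoint_def.mp hdis) x hx0 (hle hx)
    exact Subtype.ext this
  exact ⟨hinj, (LinearMap.injective_iff_surjective (K := ℂ)).mp hinj⟩

/-- `f` restricted to its rapidly expanding subspace, as an automorphism. Its integer powers,
negative ones included, make sense. -/
def rapidAut [FiniteDimensional ℂ V] (f : Module.End ℂ V) {c : ℝ} (hc : 0 ≤ c) :
    rapidSubspace f c ≃ₗ[ℂ] rapidSubspace f c :=
  LinearEquiv.ofBijective _ (rapidSubspace_bijective f hc)

/-- `W` is the `f`-invariant subspace of a Jordan block of size `s` with eigenvalue `θ`: it has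
a basis in which `f` is the Jordan cell of size `s`, and it is a direct summand of the whole
space as an `f`-invariant subspace. -/
def IsJordanBlockSubspace (f : Module.End ℂ V) (θ : ℂ) (s : ℕ) (W : Submodule ℂ V) : Prop :=
  (∃ u : Fin s → V, LinearIndependent ℂ u ∧ Submodule.span ℂ (Set.range u) = W ∧
    (∀ i : Fin s, (i : ℕ) = 0 → f (u i) = θ • u i) ∧
    (∀ i j : Fin s, (j : ℕ) = (i : ℕ) + 1 → f (u j) = θ • u j + u i)) ∧
  ∃ W' : Submodule ℂ V, IsCompl W W' ∧ ∀ x ∈ W', f x ∈ W'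

end LinearAlgebra

/-! ### Lipschitz domains -/

/-- A bounded open set whose boundary is covered by finitely many Lipschitz images of the unit
cube `[0,1]^{d-1}` (each image is given as the image of the cube under a Lipschitz map
`ℝ^{d-1} → ℝ^d`; this is no restriction, as Lipschitz maps extend). -/
def IsLipschitzDomain {d : ℕ} (Ω : Set (EuclideanSpace ℝ (Fin d))) : Prop :=
  IsOpen Ω ∧ Bornology.IsBounded Ω ∧
  ∃ (N : ℕ) (h : Fin N → EuclideanSpace ℝ (Fin (d - 1)) → EuclideanSpace ℝ (Fin d)),
    (∀ i, ∃ K, LipschitzWith K (h i)) ∧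
    frontier Ω ⊆ ⋃ i, h i '' {x | ∀ j, x j ∈ Set.Icc (0 : ℝ) 1}

/-! ### Tiles and tile-substitutions -/

/-- A translate of a prototile, recorded by its type `i` and its translation vector `x`. Relative
to the prototile supports `A` it is the tile `(A i + x, i)`. As the supports are compact and
non-empty, `x` is determined by the tile. -/
@[ext] structure Tile (d m : ℕ) where
  type : Fin m
  pos : EuclideanSpace ℝ (Fin d)

namespace Tile

variable {d m : ℕ}

/-- The translate `T + y`. -/
def translate (y : EuclideanSpace ℝ (Fin d)) (t : Tile d m) : Tile d m := ⟨t.type, t.pos + y⟩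

/-- The support `A_i + x`. -/
def supp (A : Fin m → Set (EuclideanSpace ℝ (Fin d))) (t : Tile d m) :
    Set (EuclideanSpace ℝ (Fin d)) :=
  (fun a => a + t.pos) '' A t.type

end Tile

/-- A tile-substitution in `ℝ^d` with `m` prototiles `(A_j, j)` whose expansion `φ` is a similitude
with linear dilatation `lam > 1`. The patch `ω(T_j)` is `sub j`: its tiles have pairwise disjoint
interiors and cover exactly `φ A_j`. -/
structure SelfSimilarTileSubstitution (d m : ℕ) where
  /-- the expansion map -/
  φ : EuclideanSpace ℝ (Fin d) ≃ₗ[ℝ] EuclideanSpace ℝ (Fin d)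
  /-- the linear dilatation -/
  lam : ℝ
  one_lt_lam : 1 < lam
  norm_φ : ∀ x, ‖φ x‖ = lam * ‖x‖
  /-- the supports of the prototiles -/
  A : Fin m → Set (EuclideanSpace ℝ (Fin d))
  nonempty_A : ∀ j, (A j).Nonempty
  isCompact_A : ∀ j, IsCompact (A j)
  closure_interior_A : ∀ j, closure (interior (A j)) = A j
  /-- the patch `ω(T_j)` -/
  sub : Fin m → Finset (Tile d m)
  disjoint_sub : ∀ j, ∀ t ∈ sub j, ∀ t' ∈ sub j, t ≠ t' →
    Disjoint (interior (t.supp A)) (interior (t'.supp A))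
  supp_sub : ∀ j, (⋃ t ∈ sub j, t.supp A) = φ '' A j

namespace SelfSimilarTileSubstitution

variable {d m : ℕ} (ω : SelfSimilarTileSubstitution d m)

/-- The action of the substitution on sets of tiles: `ω(T_j + y) = ω(T_j) + φ y`. -/
def subst (P : Set (Tile d m)) : Set (Tile d m) :=
  {t | ∃ p ∈ P, ∃ q ∈ ω.sub p.type, t = q.translate (ω.φ p.pos)}

/-- The patch `ω^n(T_j)`. -/
def iterPatch (n : ℕ) (j : Fin m) : Set (Tile d m) := ω.subst^[n] {⟨j, 0⟩}

/-- The support of a set of tiles. -/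
def suppSet (P : Set (Tile d m)) : Set (EuclideanSpace ℝ (Fin d)) := ⋃ t ∈ P, t.supp ω.A

/-- The substitution matrix: the `(i, j)` entry is the number of tiles of type `i` in `ω(T_j)`. -/
def substMatrix : Matrix (Fin m) (Fin m) ℕ :=
  Matrix.of fun i j => {t ∈ ω.sub j | t.type = i}.card

/-- The substitution matrix is primitive: some power `S^k`, `k ≥ 1`, is entrywise positive. -/
def IsPrimitive : Prop := ∃ k : ℕ, 0 < k ∧ ∀ i j, 0 < (ω.substMatrix ^ k) i j

/-- A set of translates of prototiles that covers `ℝ^d`, distinct tiles having disjoint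
interiors. -/
def IsTiling (T : Set (Tile d m)) : Prop :=
  ω.suppSet T = Set.univ ∧
  ∀ t ∈ T, ∀ t' ∈ T, t ≠ t' → Disjoint (interior (t.supp ω.A)) (interior (t'.supp ω.A))

/-- The tiling space `X_ω`: all tilings every patch of which is a translate of a subpatch of
some `ω^n(T_j)`. -/
def tilingSpace : Set (Set (Tile d m)) :=
  {T | ω.IsTiling T ∧ ∀ P ⊆ T, P.Finite →
    ∃ (n : ℕ) (j : Fin m) (y : EuclideanSpace ℝ (Fin d)), Tile.translate y '' P ⊆ ω.iterPatch n j}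

/-- Finite local complexity: up to translation there are only finitely many subpatches of the
`ω^n(T_j)` of diameter less than any given `r`. -/
def HasFLC : Prop :=
  ∀ r : ℝ, 0 < r → ∃ F : Set (Set (Tile d m)), F.Finite ∧
    ∀ (n : ℕ) (j : Fin m) (P : Set (Tile d m)), P ⊆ ω.iterPatch n j →
      Metric.diam (ω.suppSet P) < r → ∃ Q ∈ F, ∃ y, P = Tile.translate y '' Q

/-- No tiling of the tiling space has a non-zero translation period. -/
def IsNonPeriodic : Prop :=
  ∀ T ∈ ω.tilingSpace, ∀ y, Tile.translate y '' T = T → y = 0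

/-! ### Tiles of order `k` -/

/-- Read as a tile of order `k`, the pair `(i, x)` stands for `φ^k(T_i) + x`; this is its
support. -/
def orderSupp (k : ℤ) (t : Tile d m) : Set (EuclideanSpace ℝ (Fin d)) :=
  (fun a => (ω.φ ^ k) a + t.pos) '' ω.A t.type

/-- The subdivision of tiles of order `k` into tiles of order `k - 1`:
`φ^k(T_j) + y` is replaced by the tiles of `φ^(k-1)(ω(T_j)) + y`. -/
def subdivide (k : ℤ) (P : Set (Tile d m)) : Set (Tile d m) :=
  {t | ∃ p ∈ P, ∃ q ∈ ω.sub p.type, t = ⟨q.type, (ω.φ ^ (k - 1)) q.pos + p.pos⟩}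

/-- The sub-tiling `T^(-n)` of order `-n`, obtained from `T` by subdividing `n` times. -/
def subTiling (T : Set (Tile d m)) : ℕ → Set (Tile d m)
  | 0 => T
  | n + 1 => ω.subdivide (-(n : ℤ)) (subTiling T n)

/-! ### The finitely-additive measures -/

/-- The transpose of the substitution matrix, acting on `ℂ^m` with the Euclidean norm. -/
def St : Module.End ℂ (EuclideanSpace ℂ (Fin m)) :=
  Matrix.toEuclideanLin (ω.substMatrix.transpose.map (Nat.cast : ℕ → ℂ))

lemma threshold_nonneg : 0 ≤ ω.lam ^ (d - 1) :=
  pow_nonneg (zero_le_one.trans ω.one_lt_lam.le) _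

/-- The rapidly expanding subspace `E^{++}`: the span of the Jordan cells of `S^t` with
`|θ| > lam^(d-1)`. -/
abbrev Epp : Submodule ℂ (EuclideanSpace ℂ (Fin m)) := rapidSubspace ω.St (ω.lam ^ (d - 1))

/-- `(S^t)^k v` for `k ∈ ℤ` and `v ∈ E^{++}`. -/
def stPow (k : ℤ) (v : ω.Epp) : EuclideanSpace ℂ (Fin m) :=
  ((rapidAut ω.St ω.threshold_nonneg ^ k) v : ω.Epp)

/-- The measure of (the support of) a tile of order `k` and type `j`, namely `((S^t)^k v)_j`. -/
def tileMeasure (v : ω.Epp) (k : ℤ) (t : Tile d m) : ℂ := ω.stPow k v t.type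

/-- The measure of `supp(T^(-n)|_Ω)`, by additivity: the sum over the tiles of `T^(-n)` whose
supports lie in `Ω`. -/
def innerMeasure (v : ω.Epp) (T : Set (Tile d m)) (Ω : Set (EuclideanSpace ℝ (Fin d)))
    (n : ℕ) : ℂ :=
  ∑ᶠ t ∈ {t | t ∈ ω.subTiling T n ∧ ω.orderSupp (-(n : ℤ)) t ⊆ Ω}, ω.tileMeasure v (-(n : ℤ)) t

/-- `Φ^+_{v,T}(Ω)`, the limit of the measures of `supp(T^(k)|_Ω)` as `k → -∞`. -/
def Phi (v : ω.Epp) (T : Set (Tile d m)) (Ω : Set (EuclideanSpace ℝ (Fin d))) : ℂ :=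
  limUnder atTop (ω.innerMeasure v T Ω)

end SelfSimilarTileSubstitution

end

/-! ### Growth of powers on a Jordan block. -/

section JordanGrowth

variable {V : Type*} [AddCommGroup V] [Module ℂ V]

/-! Compare the sums over the tiles of `R • Ω` in consecutive orders. Since `S^t` sends the weights
of order `k - 1` to those of order `k`, subdividing a tile inside the domain does not change the sum
(`sum_stPow`). Only tiles crossing the boundary matter, and there are `O((R / lam^k)^(d-1))` of
them. So one step costs at most a constant times `(R / lam^k)^(d-1) * ‖(S^t)^(k-1) v‖`
(`exists_norm_levelSum_subdivide_sub_le`).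

On the block, `(S^t)^(±n) v` is `O((n+1)^(s-1) |θ|^(±n))`, and a non-zero `v` in `E^{++}` forces
`|θ| > lam^(d-1)`. Hence for `k → -∞` the errors are dominated by a polynomial times a geometric
series of ratio `lam^(d-1) / |θ| < 1`: the limit exists, within `O(R^(d-1))` of the sum of order `0`
(`exists_tendsto_innerMeasure`).

For the sum of order `0` itself, the part of the tiling in `R • Ω` is read inside some `ω^n(T_j)`,
whose tiles come grouped into supertiles (`exists_superPatch_inter_eq`). Climb to order `K` with
`lam^K ≤ R`, stopping when boundedly many supertiles fit in `R • Ω`. The errors now grow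
geometrically, so the top order dominates and everything is `O((log R)^(s-1) R^α)`
(`exists_norm_innerMeasure_zero_le`). -/

lemma Module.End.exists_norm_pow_apply_le {V : Type*} [NormedAddCommGroup V] [NormedSpace ℂ V]
    [FiniteDimensional ℂ V] (f : Module.End ℂ V) {μ : ℂ} (hμ : μ ≠ 0) (s : ℕ) :
    ∃ C : ℝ, 0 ≤ C ∧ ∀ v, ((f - algebraMap ℂ (Module.End ℂ V) μ) ^ s) v = 0 → ∀ n : ℕ,
      ‖(f ^ n) v‖ ≤ C * ((n : ℝ) + 1) ^ (s - 1) * ‖μ‖ ^ n * ‖v‖ := by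
  set N : Module.End ℂ V := f - algebraMap ℂ (Module.End ℂ V) μ with hN
  have hμ' : 0 < ‖μ‖ := norm_pos_iff.2 hμ
  set L := LinearMap.toContinuousLinearMap N with hL
  have hNi : ∀ (i : ℕ) (v : V), ‖(N ^ i) v‖ ≤ ‖L‖ ^ i * ‖v‖ := by
    intro i v
    induction i with
    | zero => simp
    | succ i ih =>
      rw [pow_succ', pow_succ', mul_assoc]
      exact (L.le_opNorm _).trans (mul_le_mul_of_nonneg_left ih (norm_nonneg _))
  refine ⟨∑ i ∈ Finset.range s, (‖L‖ / ‖μ‖) ^ i, Finset.sum_nonneg fun i _ => by positivity, ?_⟩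
  intro v hv n
  have hvan : ∀ i, s ≤ i → (N ^ i) v = 0 := by
    intro i hi
    obtain ⟨j, rfl⟩ := Nat.exists_eq_add_of_le' hi
    rw [pow_add, Module.End.mul_apply, hv, map_zero]
  have hf : f = N + algebraMap ℂ (Module.End ℂ V) μ := by simp [hN]
  -- Binomial expansion of `(N + μ)^n`; by `hvan` only the terms with `i < s` survive.
  have hexp : (f ^ n) v = ∑ i ∈ Finset.range (n + 1),
      ((n.choose i : ℂ) * μ ^ (n - i)) • (N ^ i) v := by
    rw [hf, (show Commute N _ from (Algebra.commutes μ N).symm).add_pow, LinearMap.sum_apply]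
    refine Finset.sum_congr rfl fun i _ => ?_
    rw [← map_pow, ← map_natCast (algebraMap ℂ (Module.End ℂ V)), mul_assoc, ← map_mul,
      ← Algebra.commutes, Module.End.mul_apply, Module.algebraMap_end_apply, mul_comm]
  rw [hexp]
  -- `n.choose i ≤ (n + 1)^i ≤ (n + 1)^(s - 1)`: the base `n + 1 ≥ 1` allows the exponent to be
  -- raised, also at `n = 0`.
  have hbound : ∀ i ∈ Finset.range (n + 1), ‖((n.choose i : ℂ) * μ ^ (n - i)) • (N ^ i) v‖ ≤
      if i < s then (‖L‖ / ‖μ‖) ^ i * (((n : ℝ) + 1) ^ (s - 1) * ‖μ‖ ^ n * ‖v‖) else 0 := by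
    intro i hi
    split_ifs with his
    · rw [norm_smul, norm_mul, norm_pow, Complex.norm_natCast]
      have h1 : (n.choose i : ℝ) ≤ ((n : ℝ) + 1) ^ (s - 1) :=
        calc (n.choose i : ℝ) ≤ (n : ℝ) ^ i := by exact_mod_cast Nat.choose_le_pow n i
          _ ≤ ((n : ℝ) + 1) ^ i := by gcongr; linarith
          _ ≤ ((n : ℝ) + 1) ^ (s - 1) := by
              apply pow_le_pow_right₀
              · linarith [n.cast_nonneg (α := ℝ)]
              · omega
      have h2 : ‖μ‖ ^ (n - i) = ‖μ‖ ^ n / ‖μ‖ ^ i := by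
        rw [pow_sub₀ _ hμ'.ne' (by simpa [Nat.lt_succ_iff] using hi)]; rfl
      calc (n.choose i : ℝ) * ‖μ‖ ^ (n - i) * ‖(N ^ i) v‖
          ≤ ((n : ℝ) + 1) ^ (s - 1) * ‖μ‖ ^ (n - i) * (‖L‖ ^ i * ‖v‖) := by
            gcongr; exact hNi i v
        _ = _ := by rw [h2, div_pow]; ring
    · rw [hvan i (not_lt.1 his), smul_zero, norm_zero]
  refine (norm_sum_le_of_le _ hbound).trans ?_
  have hC : (∑ i ∈ Finset.range s, (‖L‖ / ‖μ‖) ^ i) * ((n : ℝ) + 1) ^ (s - 1) * ‖μ‖ ^ n * ‖v‖ =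
      ∑ i ∈ Finset.range s, (‖L‖ / ‖μ‖) ^ i * (((n : ℝ) + 1) ^ (s - 1) * ‖μ‖ ^ n * ‖v‖) := by
    rw [← Finset.sum_mul]; ring
  rw [hC, ← Finset.sum_filter]
  refine Finset.sum_le_sum_of_subset_of_nonneg ?_ fun i _ _ => by positivity
  intro i hi
  simpa using (Finset.mem_filter.1 hi).2

/-- `f - θ` shifts the Jordan basis down by one and kills its first vector. The estimates use only
this nilpotency and the size of the block. -/
lemma IsJordanBlockSubspace.pow_sub_apply_eq_zero {f : Module.End ℂ V} {θ : ℂ} {s : ℕ}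
    {W : Submodule ℂ V} (h : IsJordanBlockSubspace f θ s W) {v : V} (hv : v ∈ W) :
    ((f - algebraMap ℂ (Module.End ℂ V) θ) ^ s) v = 0 := by
  obtain ⟨⟨u, -, hspan, h0, hs⟩, -⟩ := h
  set N := f - algebraMap ℂ (Module.End ℂ V) θ with hN
  have key : ∀ (k : ℕ) (i : Fin s), (i : ℕ) = k → (N ^ (k + 1)) (u i) = 0 := by
    intro k
    induction k with
    | zero =>
      intro i hi
      simp [hN, h0 i hi, Module.algebraMap_end_apply]
    | succ k ih =>
      intro i hi
      have hk : k < s := by have := i.2; omega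
      have := hs ⟨k, hk⟩ i (by simpa using hi)
      have hNu : N (u i) = u ⟨k, hk⟩ := by
        simp [hN, this, Module.algebraMap_end_apply]
      rw [pow_succ, Module.End.mul_apply, hNu, ih _ rfl]
  have hle : W ≤ LinearMap.ker (N ^ s) := by
    rw [← hspan, Submodule.span_le]
    rintro _ ⟨i, rfl⟩
    have hi : (i : ℕ) + 1 ≤ s := i.2
    obtain ⟨j, hj⟩ := Nat.exists_eq_add_of_le' hi
    rw [SetLike.mem_coe, LinearMap.mem_ker]
    have : (N ^ s) (u i) = (N ^ j) ((N ^ ((i : ℕ) + 1)) (u i)) := by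
      rw [← Module.End.mul_apply, ← pow_add, ← hj]
    rw [this, key _ i rfl, map_zero]
  exact hle hv

lemma IsJordanBlockSubspace.size_le [FiniteDimensional ℂ V] {f : Module.End ℂ V} {θ : ℂ} {s : ℕ}
    {W : Submodule ℂ V} (h : IsJordanBlockSubspace f θ s W) : s ≤ Module.finrank ℂ V := by
  obtain ⟨⟨u, hu, -⟩, -⟩ := h
  simpa using hu.fintype_card_le_finrank

/-- Otherwise `v` lies both in the generalized eigenspace of `θ` and in the sum of the others, which
are independent. -/
lemma lt_norm_of_mem_rapidSubspace {f : Module.End ℂ V} {c : ℝ} {θ : ℂ} {s : ℕ} {v : V}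
    (hv : v ∈ rapidSubspace f c) (h0 : v ≠ 0)
    (hs : ((f - algebraMap ℂ (Module.End ℂ V) θ) ^ s) v = 0) : c < ‖θ‖ := by
  by_contra hθ
  have hvθ : v ∈ f.maxGenEigenspace θ := by
    rw [Module.End.mem_maxGenEigenspace]
    exact ⟨s, hs⟩
  have hle : rapidSubspace f c ≤ ⨆ η : ℂ, ⨆ _ : η ≠ θ, f.maxGenEigenspace η := by
    refine iSup₂_le fun η hη => ?_
    have hne : η ≠ θ := by
      rintro rfl
      exact hθ hη
    exact le_iSup₂ (f := fun (η : ℂ) (_ : η ≠ θ) => f.maxGenEigenspace η) η hne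
  exact h0 ((Submodule.disjoint_def.mp (f.independent_maxGenEigenspace θ)) v hvθ (hle hv))

lemma hasEigenvalue_of_pow_sub_apply_eq_zero {f : Module.End ℂ V} {θ : ℂ} {s : ℕ} {v : V}
    (h0 : v ≠ 0) (hs : ((f - algebraMap ℂ (Module.End ℂ V) θ) ^ s) v = 0) :
    f.HasEigenvalue θ := by
  refine Module.End.hasEigenvalue_of_hasGenEigenvalue (k := s) ?_
  intro hbot
  refine h0 ?_
  have : v ∈ f.genEigenspace θ s := by
    rw [Module.End.mem_genEigenspace_nat]
    exact hs
  rw [hbot] at this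
  simpa using this

/-- `g⁻¹ - θ⁻¹ = -θ⁻¹ g⁻¹ (g - θ)` with commuting factors. Decay of negative powers thus follows
from the growth bound applied to `g⁻¹`. -/
lemma LinearEquiv.pow_symm_sub_apply_eq_zero (g : V ≃ₗ[ℂ] V) {θ : ℂ} (hθ : θ ≠ 0) {s : ℕ} {v : V}
    (hs : (((g : Module.End ℂ V) - algebraMap ℂ (Module.End ℂ V) θ) ^ s) v = 0) :
    (((g.symm : Module.End ℂ V) - algebraMap ℂ (Module.End ℂ V) θ⁻¹) ^ s) v = 0 := by
  set f : Module.End ℂ V := (g : Module.End ℂ V)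
  set f' : Module.End ℂ V := (g.symm : Module.End ℂ V)
  have h1 : f' * f = 1 := by ext x; simp [f, f']
  have h2 : f * f' = 1 := by ext x; simp [f, f']
  set a := algebraMap ℂ (Module.End ℂ V) (-θ⁻¹) with ha
  have hcomm : Commute (a * f') (f - algebraMap ℂ (Module.End ℂ V) θ) := by
    refine Commute.mul_left (Algebra.commutes _ _) ?_
    refine Commute.sub_right ?_ (Algebra.commutes _ _).symm
    exact h1.trans h2.symm
  have h3 : f' - algebraMap ℂ (Module.End ℂ V) θ⁻¹ =
      a * f' * (f - algebraMap ℂ (Module.End ℂ V) θ) := by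
    rw [mul_sub, mul_assoc, h1, mul_assoc, ← Algebra.commutes, ← mul_assoc, ha, ← map_mul,
      neg_mul, inv_mul_cancel₀ hθ]
    simp [sub_eq_add_neg, add_comm]
  rw [h3, hcomm.mul_pow, Module.End.mul_apply, hs, map_zero]

end JordanGrowth

/-! ### Powers of `S^t` on `E^{++}`. -/

namespace SelfSimilarTileSubstitution

variable {d m : ℕ} (ω : SelfSimilarTileSubstitution d m)

lemma lam_pos : 0 < ω.lam := zero_lt_one.trans ω.one_lt_lam

lemma coe_pow_sub_rapidAut (θ : ℂ) (s : ℕ) (v : ω.Epp) :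
    ((((rapidAut ω.St ω.threshold_nonneg : Module.End ℂ ω.Epp) -
      algebraMap ℂ (Module.End ℂ ω.Epp) θ) ^ s) v : EuclideanSpace ℂ (Fin m)) =
    ((ω.St - algebraMap ℂ _ θ) ^ s) (v : EuclideanSpace ℂ (Fin m)) := by
  induction s with
  | zero => simp
  | succ s ih =>
    rw [pow_succ', pow_succ', Module.End.mul_apply, Module.End.mul_apply, ← ih]
    simp only [LinearMap.sub_apply, Module.algebraMap_end_apply, Submodule.coe_sub,
      Submodule.coe_smul]
    rfl

/-- Growth and decay of the vectors of a generalized eigenspace under the powers of `S^t`. -/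
lemma exists_norm_stPow_le {θ : ℂ} (hθ : θ ≠ 0) (s : ℕ) :
    ∃ C : ℝ, 0 ≤ C ∧ ∀ v : ω.Epp,
      ((ω.St - algebraMap ℂ _ θ) ^ s) (v : EuclideanSpace ℂ (Fin m)) = 0 → ∀ n : ℕ,
      ‖ω.stPow n v‖ ≤ C * ((n : ℝ) + 1) ^ (s - 1) * ‖θ‖ ^ n * ‖v‖ ∧
      ‖ω.stPow (-(n : ℤ)) v‖ ≤ C * ((n : ℝ) + 1) ^ (s - 1) * (‖θ‖⁻¹) ^ n * ‖v‖ := by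
  set g := rapidAut ω.St ω.threshold_nonneg
  obtain ⟨C₁, h₁, hC₁⟩ := Module.End.exists_norm_pow_apply_le (g : Module.End ℂ ω.Epp) hθ s
  obtain ⟨C₂, h₂, hC₂⟩ :=
    Module.End.exists_norm_pow_apply_le (g.symm : Module.End ℂ ω.Epp) (inv_ne_zero hθ) s
  have hpow : ∀ (e : ω.Epp ≃ₗ[ℂ] ω.Epp) (n : ℕ) (v : ω.Epp),
      (e ^ n) v = ((e : Module.End ℂ ω.Epp) ^ n) v := by
    intro e n v
    induction n with
    | zero => rfl
    | succ n ih => rw [pow_succ', pow_succ', Module.End.mul_apply, ← ih]; rfl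
  refine ⟨max C₁ C₂, le_max_of_le_left h₁, fun v hv n => ?_⟩
  have hv' : (((g : Module.End ℂ ω.Epp) - algebraMap ℂ _ θ) ^ s) v = 0 :=
    Subtype.ext (by rw [ω.coe_pow_sub_rapidAut, hv]; rfl)
  constructor
  · have h := hC₁ v hv' n
    rw [← hpow] at h
    refine le_trans ?_ (h.trans ?_)
    · unfold stPow
      rw [zpow_natCast]
      exact le_rfl
    · gcongr
      exact le_max_left _ _
  · have h := hC₂ v (g.pow_symm_sub_apply_eq_zero hθ hv') n
    rw [← hpow, norm_inv] at h
    refine le_trans ?_ (h.trans ?_)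
    · unfold stPow
      rw [zpow_neg, zpow_natCast, ← inv_pow]
      exact le_rfl
    · gcongr
      exact le_max_right _ _

/-- Row `j` of `S^t` counts the tiles of `ω(T_j)` by type, so grouping the sum by type gives `S^t
((S^t)^(k-1) v)` at `j`. This is the additivity of the tile measures under subdivision. -/
lemma sum_stPow (v : ω.Epp) (k : ℤ) (j : Fin m) :
    ∑ q ∈ ω.sub j, ω.stPow (k - 1) v q.type = ω.stPow k v j := by
  have h1 : ω.stPow k v = ω.St (ω.stPow (k - 1) v) := by
    unfold stPow
    have : rapidAut ω.St ω.threshold_nonneg ^ k =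
        rapidAut ω.St ω.threshold_nonneg * rapidAut ω.St ω.threshold_nonneg ^ (k - 1) := by
      rw [mul_self_zpow, sub_add_cancel]
    rw [this]
    rfl
  rw [h1, St, Matrix.toLpLin_apply]
  simp only [Matrix.mulVec, dotProduct, Matrix.map_apply, Matrix.transpose_apply, substMatrix,
    Matrix.of_apply]
  rw [← Finset.sum_fiberwise (ω.sub j) (fun t => t.type)]
  refine Finset.sum_congr rfl fun i _ => ?_
  rw [Finset.sum_congr rfl (g := fun _ => ω.stPow (k - 1) v i)
    (fun t ht => by rw [(Finset.mem_filter.1 ht).2])]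
  simp

end SelfSimilarTileSubstitution

/-! ### Volume counting and covers of the boundary. -/

section Geometry

open MeasureTheory Metric

/-- Compare Haar measures; the volume of the unit ball cancels. -/
lemma card_mul_pow_le_of_pairwiseDisjoint_ball {E : Type*} [NormedAddCommGroup E]
    [NormedSpace ℝ E] [FiniteDimensional ℝ E] [Nontrivial E] {ι : Type*} (F : Finset ι)
    (c : ι → E) {ρ L : ℝ} (x : E) (hρ : 0 ≤ ρ) (hL : 0 ≤ L)
    (hdis : (F : Set ι).PairwiseDisjoint fun i => ball (c i) ρ)
    (hsub : ∀ i ∈ F, ball (c i) ρ ⊆ ball x L) :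
    (F.card : ℝ) * ρ ^ Module.finrank ℝ E ≤ L ^ Module.finrank ℝ E := by
  borelize E
  have h1 : (Measure.addHaar : Measure E) (⋃ i ∈ F, ball (c i) ρ) ≤
      (Measure.addHaar : Measure E) (ball x L) :=
    measure_mono (Set.iUnion₂_subset hsub)
  rw [measure_biUnion_finset hdis fun i _ => measurableSet_ball,
    Finset.sum_congr rfl fun i _ => Measure.addHaar_ball Measure.addHaar (c i) hρ,
    Measure.addHaar_ball _ _ hL, Finset.sum_const, nsmul_eq_mul, ← mul_assoc] at h1
  have h2 := (ENNReal.mul_le_mul_iff_left (measure_ball_pos _ (0 : E) one_pos).ne'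
    measure_ball_lt_top.ne).1 h1
  rw [← ENNReal.ofReal_natCast, ← ENNReal.ofReal_mul (Nat.cast_nonneg _)] at h2
  exact (ENNReal.ofReal_le_ofReal_iff (by positivity)).1 h2

lemma IsPreconnected.inter_frontier_nonempty_of_isOpen {X : Type*} [TopologicalSpace X]
    {s U : Set X} (hs : IsPreconnected s) (hU : IsOpen U) (h1 : (s ∩ U).Nonempty)
    (h2 : ¬ s ⊆ U) : (s ∩ frontier U).Nonempty := by
  by_contra h
  rw [Set.not_nonempty_iff_eq_empty] at h
  refine h2 (hs.subset_left_of_subset_union hU isClosed_closure.isOpen_compl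
    (disjoint_compl_right.mono_right (Set.compl_subset_compl.2 subset_closure)) ?_ h1)
  intro x hx
  by_cases hxU : x ∈ U
  · exact Or.inl hxU
  · refine Or.inr fun hxc => ?_
    have : x ∈ s ∩ frontier U := ⟨hx, by rw [hU.frontier_eq]; exact ⟨hxc, hxU⟩⟩
    rw [h] at this
    exact this

/-- Round every coordinate down to the grid of mesh `1 / L`: the error is at most `√e / L ≤ (e + 1)
/ L`. -/
lemma exists_finset_cover_unitCube (e L : ℕ) (hL : 0 < L) :
    ∃ G : Finset (EuclideanSpace ℝ (Fin e)), G.card ≤ (L + 1) ^ e ∧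
      ∀ x : EuclideanSpace ℝ (Fin e), (∀ j, x j ∈ Set.Icc (0 : ℝ) 1) →
        ∃ g ∈ G, dist x g ≤ ((e : ℝ) + 1) / L := by
  classical
  have hL' : (0 : ℝ) < L := by exact_mod_cast hL
  refine ⟨Finset.univ.image fun a : Fin e → Fin (L + 1) =>
    WithLp.toLp 2 fun j => ((a j : ℕ) : ℝ) / L, ?_, ?_⟩
  · refine Finset.card_image_le.trans ?_
    simp
  · intro x hx
    have hfl : ∀ j, ⌊x j * L⌋₊ < L + 1 := by
      intro j
      rw [Nat.lt_succ_iff]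
      refine Nat.floor_le_of_le ?_
      exact mul_le_of_le_one_left hL'.le (hx j).2
    refine ⟨_, Finset.mem_image.2 ⟨fun j => ⟨⌊x j * L⌋₊, hfl j⟩, Finset.mem_univ _, rfl⟩, ?_⟩
    rw [EuclideanSpace.dist_eq, Real.sqrt_le_left (by positivity)]
    have hj : ∀ j, dist (x j) ((⌊x j * L⌋₊ : ℝ) / L) ^ 2 ≤ (1 / (L : ℝ)) ^ 2 := by
      intro j
      have h0 : 0 ≤ x j * L := mul_nonneg (hx j).1 hL'.le
      have h1 := Nat.floor_le h0
      have h2 := Nat.lt_floor_add_one (x j * L)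
      have h3 : x j = x j * L / L := by field_simp
      refine pow_le_pow_left₀ dist_nonneg ?_ 2
      rw [Real.dist_eq, h3, ← sub_div, abs_div, abs_of_pos hL', mul_div_cancel_right₀ _ hL'.ne']
      gcongr
      rw [abs_le]
      constructor <;> linarith
    refine (Finset.sum_le_sum fun j _ => hj j).trans ?_
    rw [Finset.sum_const, Finset.card_univ, Fintype.card_fin, nsmul_eq_mul, div_pow, div_pow,
      one_pow, mul_one_div]
    gcongr
    nlinarith [e.cast_nonneg (α := ℝ)]

/-- Push a grid of mesh comparable to `ρ / R` on the cube through the maps `R • h i`; it has about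
`(R / ρ)^(d-1)` points. -/
lemma IsLipschitzDomain.exists_cover_frontier {d : ℕ} {Ω : Set (EuclideanSpace ℝ (Fin d))}
    (hΩ : IsLipschitzDomain Ω) :
    ∃ C : ℝ, 0 ≤ C ∧ ∀ R ρ : ℝ, 0 < ρ → ρ ≤ R → ∃ B : Finset (EuclideanSpace ℝ (Fin d)),
      frontier (R • Ω) ⊆ ⋃ b ∈ B, closedBall b ρ ∧ (B.card : ℝ) ≤ C * (R / ρ) ^ (d - 1) := by
  classical
  obtain ⟨-, -, N, h, hlip, hcov⟩ := hΩ
  choose K hK using hlip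
  set M : ℝ := ∑ i, (K i : ℝ) with hM
  have hM0 : 0 ≤ M := Finset.sum_nonneg fun i _ => (K i).2
  have hKM : ∀ i, (K i : ℝ) ≤ M := fun i =>
    Finset.single_le_sum (f := fun i => (K i : ℝ)) (fun i _ => (K i).2) (Finset.mem_univ i)
  -- The `3` pays for the ceiling and two increments in `L + 1`; as `R / ρ ≥ 1`, it can be
  -- multiplied by `R / ρ`.
  refine ⟨N * (M * (((d - 1 : ℕ) : ℝ) + 1) + 3) ^ (d - 1), by positivity, fun R ρ hρ hR => ?_⟩
  have hR0 : 0 < R := hρ.trans_le hR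
  set L : ℕ := ⌈M * (((d - 1 : ℕ) : ℝ) + 1) * (R / ρ)⌉₊ + 1 with hLdef
  have hL : 0 < L := Nat.succ_pos _
  have hL' : (0 : ℝ) < L := by exact_mod_cast hL
  obtain ⟨G, hGcard, hG⟩ := exists_finset_cover_unitCube (d - 1) L hL
  refine ⟨(Finset.univ : Finset (Fin N)).biUnion fun i => G.image fun g => R • h i g, ?_, ?_⟩
  · intro b hb
    have hfr : frontier (R • Ω) = R • frontier Ω :=
      ((Homeomorph.smulOfNeZero R hR0.ne').image_frontier Ω).symm
    rw [hfr] at hb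
    obtain ⟨b, hb, rfl⟩ := hb
    obtain ⟨i, x, hx, rfl⟩ := Set.mem_iUnion.1 (hcov hb)
    obtain ⟨g, hg, hxg⟩ := hG x hx
    refine Set.mem_iUnion₂.2 ⟨R • h i g, ?_, ?_⟩
    · exact Finset.mem_biUnion.2 ⟨i, Finset.mem_univ _, Finset.mem_image_of_mem _ hg⟩
    · rw [mem_closedBall]
      change dist (R • h i x) (R • h i g) ≤ ρ
      rw [dist_smul₀, Real.norm_of_nonneg hR0.le]
      have h1 : M * (((d - 1 : ℕ) : ℝ) + 1) * (R / ρ) ≤ L := by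
        rw [hLdef]; push_cast
        linarith [Nat.le_ceil (M * (((d - 1 : ℕ) : ℝ) + 1) * (R / ρ))]
      calc R * dist (h i x) (h i g) ≤ R * (K i * dist x g) := by
            gcongr; exact (hK i).dist_le_mul _ _
        _ ≤ R * (M * ((((d - 1 : ℕ) : ℝ) + 1) / L)) := by gcongr; exact hKM i
        _ = (M * (((d - 1 : ℕ) : ℝ) + 1) * (R / ρ)) * ρ / L := by field_simp
        _ ≤ L * ρ / L := by gcongr
        _ = ρ := by field_simp
  · have h1 : (1 : ℝ) ≤ R / ρ := by rwa [one_le_div hρ]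
    have h2 : (L : ℝ) + 1 ≤ (M * (((d - 1 : ℕ) : ℝ) + 1) + 3) * (R / ρ) := by
      rw [hLdef]; push_cast
      have := Nat.ceil_lt_add_one (show 0 ≤ M * (((d - 1 : ℕ) : ℝ) + 1) * (R / ρ) by positivity)
      nlinarith
    have h3 : ((Finset.univ : Finset (Fin N)).biUnion fun i => G.image fun g => R • h i g).card ≤
        N * (L + 1) ^ (d - 1) := by
      refine Finset.card_biUnion_le.trans ?_
      refine (Finset.sum_le_card_nsmul _ _ _ fun i _ => Finset.card_image_le.trans hGcard).trans ?_
      simp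
    calc _ ≤ ((N * (L + 1) ^ (d - 1) : ℕ) : ℝ) := by exact_mod_cast h3
      _ = N * ((L : ℝ) + 1) ^ (d - 1) := by push_cast; ring
      _ ≤ N * ((M * (((d - 1 : ℕ) : ℝ) + 1) + 3) * (R / ρ)) ^ (d - 1) := by gcongr
      _ = _ := by rw [mul_pow]; ring

end Geometry

/-! ### Packings by tiles of order `k`. -/

namespace SelfSimilarTileSubstitution

open Metric

variable {d m : ℕ} (ω : SelfSimilarTileSubstitution d m)

lemma norm_φ_zpow (k : ℤ) (x : EuclideanSpace ℝ (Fin d)) :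
    ‖(ω.φ ^ k) x‖ = ω.lam ^ k * ‖x‖ := by
  have hnat : ∀ (n : ℕ) x, ‖(ω.φ ^ n) x‖ = ω.lam ^ n * ‖x‖ := by
    intro n
    induction n with
    | zero => intro x; simp
    | succ n ih =>
      intro x
      rw [pow_succ', pow_succ', LinearEquiv.mul_apply, ω.norm_φ, ih, mul_assoc]
  obtain ⟨n, rfl | rfl⟩ := k.eq_nat_or_neg
  · simp [hnat]
  · have h := hnat n ((ω.φ ^ (-(n : ℤ))) x)
    rw [← LinearEquiv.mul_apply, ← zpow_natCast, ← zpow_add, add_neg_cancel, zpow_zero,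
      LinearEquiv.coe_one, id] at h
    rw [h, zpow_neg ω.lam, zpow_natCast ω.lam, inv_mul_cancel_left₀ (pow_ne_zero _ ω.lam_pos.ne')]

/-- The affine similitude `a ↦ φ^k a + x`. -/
noncomputable def affineHomeo (k : ℤ) (x : EuclideanSpace ℝ (Fin d)) :
    EuclideanSpace ℝ (Fin d) ≃ₜ EuclideanSpace ℝ (Fin d) :=
  (ω.φ ^ k).toContinuousLinearEquiv.toHomeomorph.trans (Homeomorph.addRight x)

@[simp] lemma affineHomeo_apply (k : ℤ) (x a : EuclideanSpace ℝ (Fin d)) :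
    ω.affineHomeo k x a = (ω.φ ^ k) a + x := rfl

lemma dist_affineHomeo (k : ℤ) (x a b : EuclideanSpace ℝ (Fin d)) :
    dist (ω.affineHomeo k x a) (ω.affineHomeo k x b) = ω.lam ^ k * dist a b := by
  simp [dist_eq_norm, ← map_sub, norm_φ_zpow]

lemma orderSupp_eq (k : ℤ) (t : Tile d m) :
    ω.orderSupp k t = ω.affineHomeo k t.pos '' ω.A t.type := rfl

lemma orderSupp_zero (t : Tile d m) : ω.orderSupp 0 t = t.supp ω.A := by
  simp [orderSupp, Tile.supp]

lemma orderSupp_nonempty (k : ℤ) (t : Tile d m) : (ω.orderSupp k t).Nonempty :=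
  (ω.nonempty_A _).image _

lemma closure_interior_orderSupp (k : ℤ) (t : Tile d m) :
    closure (interior (ω.orderSupp k t)) = ω.orderSupp k t := by
  rw [orderSupp_eq, ← Homeomorph.image_interior, ← Homeomorph.image_closure, closure_interior_A]

lemma interior_orderSupp_nonempty (k : ℤ) (t : Tile d m) :
    (interior (ω.orderSupp k t)).Nonempty := by
  rw [← closure_nonempty_iff, closure_interior_orderSupp]
  exact ω.orderSupp_nonempty k t

/-- Two tiles of order `k` with disjoint interiors cannot overlap. -/
lemma disjoint_interior_orderSupp {k : ℤ} {t t' : Tile d m}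
    (h : Disjoint (interior (ω.orderSupp k t)) (interior (ω.orderSupp k t'))) :
    Disjoint (interior (ω.orderSupp k t)) (ω.orderSupp k t') := by
  rw [← ω.closure_interior_orderSupp k t']
  exact h.closure_right isOpen_interior

/-- The child of order `k - 1` of a tile `p` of order `k` given by a tile `q` of
`ω(T_j)`, `j` the type of `p`. -/
noncomputable def child (k : ℤ) (p q : Tile d m) : Tile d m := ⟨q.type, (ω.φ ^ (k - 1)) q.pos + p.pos⟩

lemma orderSupp_child (k : ℤ) (p q : Tile d m) :
    ω.orderSupp (k - 1) (ω.child k p q) = ω.affineHomeo (k - 1) p.pos '' q.supp ω.A := by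
  rw [Tile.supp, Set.image_image]
  simp only [orderSupp, child, affineHomeo_apply, map_add, add_assoc]

lemma orderSupp_child_subset (k : ℤ) (p : Tile d m) {q : Tile d m} (hq : q ∈ ω.sub p.type) :
    ω.orderSupp (k - 1) (ω.child k p q) ⊆ ω.orderSupp k p := by
  have h : q.supp ω.A ⊆ ω.φ '' ω.A p.type := by
    rw [← ω.supp_sub]
    exact Set.subset_biUnion_of_mem (u := fun t : Tile d m => t.supp ω.A) hq
  rw [orderSupp_child]
  refine (Set.image_mono h).trans ?_
  rw [Set.image_image]
  rintro _ ⟨a, ha, rfl⟩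
  refine ⟨a, ha, ?_⟩
  have : ω.φ ^ k = ω.φ ^ (k - 1) * ω.φ := by rw [← zpow_add_one, sub_add_cancel]
  simp [this]

/-- A family of tiles of order `k` with pairwise disjoint interiors. -/
def IsPacking (k : ℤ) (P : Set (Tile d m)) : Prop :=
  ∀ t ∈ P, ∀ t' ∈ P, t ≠ t' →
    Disjoint (interior (ω.orderSupp k t)) (interior (ω.orderSupp k t'))

variable {ω}

variable (ω) in
lemma disjoint_interior_child {k : ℤ} (p : Tile d m) {q q' : Tile d m} (hq : q ∈ ω.sub p.type)
    (hq' : q' ∈ ω.sub p.type) (h : q ≠ q') :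
    Disjoint (interior (ω.orderSupp (k - 1) (ω.child k p q)))
      (interior (ω.orderSupp (k - 1) (ω.child k p q'))) := by
  rw [orderSupp_child, orderSupp_child, ← Homeomorph.image_interior, ← Homeomorph.image_interior]
  exact (Set.disjoint_image_iff (Homeomorph.injective _)).2 (ω.disjoint_sub _ q hq q' hq' h)

lemma IsPacking.disjoint_interior_child {k : ℤ} {P : Set (Tile d m)} (h : ω.IsPacking k P)
    {p p' q q' : Tile d m} (hp : p ∈ P) (hp' : p' ∈ P) (hq : q ∈ ω.sub p.type)
    (hq' : q' ∈ ω.sub p'.type) (hne : (p, q) ≠ (p', q')) :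
    Disjoint (interior (ω.orderSupp (k - 1) (ω.child k p q)))
      (interior (ω.orderSupp (k - 1) (ω.child k p' q'))) := by
  by_cases hpp : p = p'
  · subst hpp
    exact ω.disjoint_interior_child p hq hq' fun hqq => hne (by rw [hqq])
  · exact (h p hp p' hp' hpp).mono (interior_mono (ω.orderSupp_child_subset k p hq))
      (interior_mono (ω.orderSupp_child_subset k p' hq'))

lemma IsPacking.subdivide {k : ℤ} {P : Set (Tile d m)} (h : ω.IsPacking k P) :
    ω.IsPacking (k - 1) (ω.subdivide k P) := by
  rintro _ ⟨p, hp, q, hq, rfl⟩ _ ⟨p', hp', q', hq', rfl⟩ hne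
  refine h.disjoint_interior_child hp hp' hq hq' fun heq => hne ?_
  rw [Prod.mk.injEq] at heq
  rw [heq.1, heq.2]

/-- Distinct pairs give children with disjoint, non-empty interiors. This lets a sum over the
subdivision be indexed by pairs (parent, child). -/
lemma IsPacking.child_injOn {k : ℤ} {P : Set (Tile d m)} (h : ω.IsPacking k P)
    {p p' q q' : Tile d m} (hp : p ∈ P) (hp' : p' ∈ P) (hq : q ∈ ω.sub p.type)
    (hq' : q' ∈ ω.sub p'.type) (heq : ω.child k p q = ω.child k p' q') : (p, q) = (p', q') := by
  by_contra hne
  have hd := h.disjoint_interior_child hp hp' hq hq' hne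
  rw [heq, disjoint_self] at hd
  exact (ω.interior_orderSupp_nonempty _ _).ne_empty hd

variable (ω)

/-- `D` bounds the size of the prototiles, every one of which contains a ball of radius `r`, and
`M` bounds the number of tiles of the patches `ω(T_j)`. -/
structure SizeBounds (D r : ℝ) (M : ℕ) : Prop where
  D_pos : 0 < D
  r_pos : 0 < r
  subset : ∀ j, ω.A j ⊆ closedBall 0 D
  ball_subset : ∀ j, ∃ c, ball c r ⊆ ω.A j
  card_le : ∀ j, (ω.sub j).card ≤ M

lemma exists_sizeBounds : ∃ D r M, ω.SizeBounds D r M := by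
  have hD : ∀ᶠ D : ℝ in atTop, ∀ j, ω.A j ⊆ closedBall 0 D := by
    rw [eventually_all]
    intro j
    obtain ⟨D, hD⟩ := (ω.isCompact_A j).isBounded.subset_closedBall 0
    filter_upwards [eventually_ge_atTop D] with D' h
    exact hD.trans (closedBall_subset_closedBall h)
  have hr : ∀ᶠ r : ℝ in 𝓝[>] 0, ∀ j, ∃ c, ball c r ⊆ ω.A j := by
    rw [eventually_all]
    intro j
    have hne : (interior (ω.A j)).Nonempty := by
      rw [← closure_nonempty_iff, ω.closure_interior_A]
      exact ω.nonempty_A j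
    obtain ⟨c, hc⟩ := hne
    obtain ⟨ε, hε, hsub⟩ := Metric.isOpen_iff.1 isOpen_interior c hc
    filter_upwards [Ioo_mem_nhdsGT hε] with r hr
    exact ⟨c, (ball_subset_ball hr.2.le).trans (hsub.trans interior_subset)⟩
  obtain ⟨D, hD, hD0⟩ := (hD.and (eventually_gt_atTop 0)).exists
  obtain ⟨r, hr, hr0⟩ := (hr.and self_mem_nhdsWithin).exists
  exact ⟨D, r, Finset.univ.sup fun j => (ω.sub j).card, hD0, hr0, hD, hr,
    fun j => Finset.le_sup (f := fun j => (ω.sub j).card) (Finset.mem_univ j)⟩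

variable {ω} {D r : ℝ} {M : ℕ}

lemma SizeBounds.orderSupp_subset (hb : ω.SizeBounds D r M) (k : ℤ) (t : Tile d m) :
    ω.orderSupp k t ⊆ closedBall t.pos (D * ω.lam ^ k) := by
  rintro _ ⟨a, ha, rfl⟩
  have h := hb.subset _ ha
  rw [mem_closedBall_zero_iff] at h
  rw [mem_closedBall, dist_eq_norm, add_sub_cancel_right, norm_φ_zpow, mul_comm]
  exact mul_le_mul_of_nonneg_right h (zpow_nonneg ω.lam_pos.le k)

lemma SizeBounds.exists_ball_subset (hb : ω.SizeBounds D r M) (k : ℤ) (t : Tile d m) :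
    ∃ c, ball c (r * ω.lam ^ k) ⊆ interior (ω.orderSupp k t) := by
  obtain ⟨c, hc⟩ := hb.ball_subset t.type
  refine ⟨ω.affineHomeo k t.pos c, interior_maximal ?_ isOpen_ball⟩
  intro x hx
  have hk := zpow_pos ω.lam_pos k
  obtain ⟨a, rfl⟩ := (ω.affineHomeo k t.pos).surjective x
  refine ⟨a, hc ?_, rfl⟩
  rw [mem_ball, dist_affineHomeo, mul_comm] at hx
  exact lt_of_mul_lt_mul_right hx hk.le

/-- Every tile contains a ball of radius `r * lam^k` in its interior, and these balls are disjoint.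
-/
lemma IsPacking.card_le (hd : 1 ≤ d) (hb : ω.SizeBounds D r M) {k : ℤ} {P : Set (Tile d m)}
    (h : ω.IsPacking k P) {L : ℝ} (hL : 0 ≤ L) (x : EuclideanSpace ℝ (Fin d))
    (F : Finset (Tile d m)) (hF : (F : Set (Tile d m)) ⊆ P)
    (hFx : ∀ t ∈ F, ω.orderSupp k t ⊆ ball x L) :
    (F.card : ℝ) ≤ (L / (r * ω.lam ^ k)) ^ d := by
  have : NeZero d := ⟨by omega⟩
  have hk := zpow_pos ω.lam_pos k
  choose c hc using hb.exists_ball_subset k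
  have hρ : 0 < r * ω.lam ^ k := mul_pos hb.r_pos hk
  have := card_mul_pow_le_of_pairwiseDisjoint_ball F c x hρ.le hL
    (fun t ht t' ht' hne => (h t (hF ht) t' (hF ht') hne).mono (hc t) (hc t'))
    (fun t ht => (hc t).trans (interior_subset.trans (hFx t ht)))
  rw [finrank_euclideanSpace_fin] at this
  rw [div_pow, le_div_iff₀ (pow_pos hρ d)]
  exact this

lemma IsPacking.finite_inter (hd : 1 ≤ d) {k : ℤ} {P : Set (Tile d m)}
    (h : ω.IsPacking k P) {U : Set (EuclideanSpace ℝ (Fin d))} (hU : Bornology.IsBounded U) :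
    {t | t ∈ P ∧ (ω.orderSupp k t ∩ U).Nonempty}.Finite := by
  obtain ⟨D, r, M, hb⟩ := ω.exists_sizeBounds
  have hk := zpow_pos ω.lam_pos k
  obtain ⟨B, hB0, hB⟩ := hU.subset_ball_lt 0 0
  by_contra hinf
  set L := B + 3 * (D * ω.lam ^ k) with hLdef
  have hDk : 0 < D * ω.lam ^ k := mul_pos hb.D_pos hk
  have hL : 0 ≤ L := by positivity
  obtain ⟨n, hn⟩ := exists_nat_gt ((L / (r * ω.lam ^ k)) ^ d)
  obtain ⟨F, hF, hcard⟩ := Set.Infinite.exists_subset_card_eq hinf n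
  refine (hn.trans_le ?_).false
  rw [← hcard]
  refine h.card_le hd hb hL 0 F (fun t ht => (hF ht).1) fun t ht y hy => ?_
  obtain ⟨z, hzt, hzU⟩ := (hF ht).2
  have h1 := hb.orderSupp_subset k t hy
  have h2 := hb.orderSupp_subset k t hzt
  have h3 := hB hzU
  rw [mem_closedBall] at h1 h2
  rw [mem_ball] at h3 ⊢
  have h4 := dist_triangle4 y t.pos z 0
  rw [dist_comm t.pos z] at h4
  linarith

/-- A tile crossing the boundary has its position within `(D + 1) * lam^k` of a centre in `B`, and
the packing bound limits the tiles per centre independently of `k`. -/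
lemma IsPacking.card_boundary_le (hd : 1 ≤ d) (hb : ω.SizeBounds D r M) {k : ℤ}
    {P : Set (Tile d m)} (h : ω.IsPacking k P) {U : Set (EuclideanSpace ℝ (Fin d))}
    (hU : IsOpen U) {B : Finset (EuclideanSpace ℝ (Fin d))}
    (hB : frontier U ⊆ ⋃ b ∈ B, closedBall b (ω.lam ^ k))
    (F : Finset (Tile d m)) (hF : (F : Set (Tile d m)) ⊆ P)
    (hFU : ∀ t ∈ F, (ω.orderSupp k t ∩ U).Nonempty ∧ ¬ ω.orderSupp k t ⊆ U) :
    F.card ≤ ⌈((2 * D + 2) / r) ^ d⌉₊ * B.card := by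
  classical
  have hk := zpow_pos ω.lam_pos k
  have hex : ∀ t : Tile d m, ∃ b, t ∈ F → b ∈ B ∧ dist t.pos b ≤ (D + 1) * ω.lam ^ k := by
    intro t
    by_cases ht : t ∈ F
    swap
    · exact ⟨0, fun h => absurd h ht⟩
    obtain ⟨h1, h2⟩ := hFU t ht
    have hsub := hb.orderSupp_subset k t
    -- The tile itself may be disconnected, so connectedness is applied to the ball containing it.
    obtain ⟨y, hy, hyU⟩ := (convex_closedBall t.pos (D * ω.lam ^ k)).isPreconnected
      |>.inter_frontier_nonempty_of_isOpen hU (h1.mono (Set.inter_subset_inter_left _ hsub))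
      fun h' => h2 (hsub.trans h')
    obtain ⟨b, hbB, hyb⟩ := Set.mem_iUnion₂.1 (hB hyU)
    refine ⟨b, fun _ => ⟨hbB, ?_⟩⟩
    rw [mem_closedBall] at hy hyb
    have := dist_triangle_left t.pos b y
    linarith
  choose c hc using hex
  refine Finset.card_le_mul_card_image_of_maps_to (f := c) (fun t ht => (hc t ht).1) _ ?_
  intro b _
  -- Position within `(D + 1) * lam^k`, extent `D * lam^k`, and a slack of `lam^k` to fit into an
  -- open ball.
  have h1 := h.card_le hd hb (L := (2 * D + 2) * ω.lam ^ k)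
    (mul_nonneg (by linarith [hb.D_pos]) hk.le) b {t ∈ F | c t = b}
    (fun t ht => hF (Finset.mem_filter.1 ht).1) (by
      intro t ht y hy
      obtain ⟨htF, rfl⟩ := Finset.mem_filter.1 ht
      have h1 := (hc t htF).2
      have h2 := hb.orderSupp_subset k t hy
      rw [mem_closedBall] at h2
      rw [mem_ball]
      have := dist_triangle y t.pos (c t)
      linarith)
  rw [mul_div_mul_right _ _ hk.ne'] at h1
  exact_mod_cast h1.trans (Nat.le_ceil _)

/-! ### Change of the sum in one subdivision. -/

variable (ω)

/-- The sum of the measures of the tiles of order `k` of `P` lying in `U`. -/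
noncomputable def levelSum (v : ω.Epp) (k : ℤ) (P : Set (Tile d m)) (U : Set (EuclideanSpace ℝ (Fin d))) : ℂ :=
  ∑ᶠ t ∈ {t | t ∈ P ∧ ω.orderSupp k t ⊆ U}, ω.tileMeasure v k t

variable {ω}

lemma norm_tileMeasure_le (v : ω.Epp) (k : ℤ) (t : Tile d m) :
    ‖ω.tileMeasure v k t‖ ≤ ‖ω.stPow k v‖ :=
  PiLp.norm_apply_le _ _

/-- A uniform bound on finite subfamilies also makes the index set finite, so the `finsum` is a
genuine finite sum. -/
lemma norm_levelSum_le (v : ω.Epp) (k : ℤ) {P : Set (Tile d m)}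
    {U : Set (EuclideanSpace ℝ (Fin d))} {c : ℝ}
    (hc : ∀ F : Finset (Tile d m), (∀ t ∈ F, t ∈ P ∧ ω.orderSupp k t ⊆ U) → (F.card : ℝ) ≤ c) :
    ‖ω.levelSum v k P U‖ ≤ c * ‖ω.stPow k v‖ := by
  have hfin : {t | t ∈ P ∧ ω.orderSupp k t ⊆ U}.Finite := by
    by_contra hinf
    obtain ⟨n, hn⟩ := exists_nat_gt c
    obtain ⟨F, hF, hcard⟩ := Set.Infinite.exists_subset_card_eq hinf n
    have := hc F fun t ht => hF ht
    rw [hcard] at this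
    linarith
  rw [levelSum, finsum_mem_eq_finite_toFinset_sum _ hfin]
  refine (norm_sum_le_of_le _ fun t _ => norm_tileMeasure_le v k t).trans ?_
  rw [Finset.sum_const, nsmul_eq_mul]
  gcongr
  exact hc _ fun t ht => hfin.mem_toFinset.1 ht

/-- Tiles inside `U` cancel against their children by `sum_stPow`, tiles missing `U` contribute
nothing, and each crossing tile contributes at most `M` children. -/
lemma IsPacking.norm_levelSum_subdivide_sub_le (hd : 1 ≤ d) (hb : ω.SizeBounds D r M) (v : ω.Epp)
    {k : ℤ} {P : Set (Tile d m)} (h : ω.IsPacking k P) {U : Set (EuclideanSpace ℝ (Fin d))}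
    (hU : IsOpen U) (hUb : Bornology.IsBounded U) {B : Finset (EuclideanSpace ℝ (Fin d))}
    (hB : frontier U ⊆ ⋃ b ∈ B, closedBall b (ω.lam ^ k)) :
    ‖ω.levelSum v (k - 1) (ω.subdivide k P) U - ω.levelSum v k P U‖ ≤
      M * ⌈((2 * D + 2) / r) ^ d⌉₊ * B.card * ‖ω.stPow (k - 1) v‖ := by
  classical
  have hfin := h.finite_inter hd hUb
  -- Both sums are rewritten over the finitely many parents meeting `U`, so that they can be
  -- compared parent by parent.
  set F := hfin.toFinset with hFdef
  have hF : ∀ p, p ∈ F ↔ p ∈ P ∧ (ω.orderSupp k p ∩ U).Nonempty := fun p => hfin.mem_toFinset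
  have h1 : ω.levelSum v k P U =
      ∑ p ∈ F, if ω.orderSupp k p ⊆ U then ω.tileMeasure v k p else 0 := by
    have hset : {t | t ∈ P ∧ ω.orderSupp k t ⊆ U} = ↑{p ∈ F | ω.orderSupp k p ⊆ U} := by
      ext p
      simp only [Set.mem_ofPred_eq, Finset.coe_filter, hF]
      refine ⟨fun hp => ⟨⟨hp.1, ?_⟩, hp.2⟩, fun hp => ⟨hp.1.1, hp.2⟩⟩
      rw [Set.inter_eq_left.2 hp.2]
      exact ω.orderSupp_nonempty k p
    rw [levelSum, hset, finsum_mem_coe_finset, Finset.sum_filter]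
  have h2 : ω.levelSum v (k - 1) (ω.subdivide k P) U = ∑ p ∈ F, ∑ q ∈ ω.sub p.type,
      if ω.orderSupp (k - 1) (ω.child k p q) ⊆ U then ω.stPow (k - 1) v q.type else 0 := by
    have hset : {t | t ∈ ω.subdivide k P ∧ ω.orderSupp (k - 1) t ⊆ U} =
        ↑(((F.sigma fun p => ω.sub p.type).filter fun a =>
          ω.orderSupp (k - 1) (ω.child k a.1 a.2) ⊆ U).image fun a => ω.child k a.1 a.2) := by
      ext t
      simp only [Set.mem_ofPred_eq, Finset.coe_image, Finset.coe_filter, Set.mem_image,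
        Finset.mem_sigma, hF]
      constructor
      · rintro ⟨⟨p, hp, q, hq, rfl⟩, hsub⟩
        refine ⟨⟨p, q⟩, ⟨⟨⟨hp, ?_⟩, hq⟩, hsub⟩, rfl⟩
        obtain ⟨x, hx⟩ := ω.orderSupp_nonempty (k - 1) (ω.child k p q)
        exact ⟨x, ω.orderSupp_child_subset k p hq hx, hsub hx⟩
      · rintro ⟨⟨p, q⟩, ⟨⟨⟨hp, -⟩, hq⟩, hsub⟩, rfl⟩
        exact ⟨⟨p, hp, q, hq, rfl⟩, hsub⟩
    rw [levelSum, hset, finsum_mem_coe_finset, Finset.sum_image, Finset.sum_filter,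
      Finset.sum_sigma]
    · rfl
    · rintro ⟨p, q⟩ ha ⟨p', q'⟩ ha' heq
      simp only [Finset.coe_filter, Set.mem_ofPred_eq, Finset.mem_sigma, hF] at ha ha'
      have := h.child_injOn ha.1.1.1 ha'.1.1.1 ha.1.2 ha'.1.2 heq
      rw [Prod.mk.injEq] at this
      rw [this.1, this.2]
  rw [h1, h2, ← Finset.sum_sub_distrib]
  have hterm : ∀ p ∈ F, ‖(∑ q ∈ ω.sub p.type,
      if ω.orderSupp (k - 1) (ω.child k p q) ⊆ U then ω.stPow (k - 1) v q.type else 0) -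
      (if ω.orderSupp k p ⊆ U then ω.tileMeasure v k p else 0)‖ ≤
      if ¬ ω.orderSupp k p ⊆ U then M * ‖ω.stPow (k - 1) v‖ else 0 := by
    intro p _
    by_cases hp : ω.orderSupp k p ⊆ U
    · rw [if_pos hp, if_neg (not_not.2 hp), Finset.sum_congr rfl fun q hq =>
        if_pos ((ω.orderSupp_child_subset k p hq).trans hp), ω.sum_stPow, tileMeasure, sub_self,
        norm_zero]
    · rw [if_neg hp, if_pos hp, sub_zero]
      have : ∀ q ∈ ω.sub p.type, ‖if ω.orderSupp (k - 1) (ω.child k p q) ⊆ U then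
          ω.stPow (k - 1) v q.type else 0‖ ≤ ‖ω.stPow (k - 1) v‖ := by
        intro q _
        split_ifs
        · exact PiLp.norm_apply_le _ _
        · simp
      refine (norm_sum_le_of_le _ this).trans ?_
      rw [Finset.sum_const, nsmul_eq_mul]
      gcongr
      exact hb.card_le _
  refine (norm_sum_le_of_le _ hterm).trans ?_
  rw [← Finset.sum_filter, Finset.sum_const, nsmul_eq_mul]
  have hcard := h.card_boundary_le hd hb hU hB {p ∈ F | ¬ ω.orderSupp k p ⊆ U}
    (fun p hp => ((hF p).1 (Finset.mem_filter.1 hp).1).1)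
    (fun p hp => ⟨((hF p).1 (Finset.mem_filter.1 hp).1).2, (Finset.mem_filter.1 hp).2⟩)
  calc _ ≤ ((⌈((2 * D + 2) / r) ^ d⌉₊ * B.card : ℕ) : ℝ) * (M * ‖ω.stPow (k - 1) v‖) := by
        gcongr
    _ = _ := by push_cast; ring

end SelfSimilarTileSubstitution

/-! ### From powers of `lam` to powers of `R`. -/

lemma pow_le_rpow_log_div_log {b l R : ℝ} {K : ℕ} (hb : 1 ≤ b) (hl : 1 < l) (hK : l ^ K ≤ R) :
    b ^ K ≤ R ^ (Real.log b / Real.log l) := by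
  have hl0 : 0 < l := zero_lt_one.trans hl
  have hR : 0 < R := (pow_pos hl0 K).trans_le hK
  have hlog : 0 < Real.log l := Real.log_pos hl
  have h1 : b = l ^ (Real.log b / Real.log l) := by
    rw [Real.rpow_def_of_pos hl0, mul_div_cancel₀ _ hlog.ne', Real.exp_log (by linarith)]
  calc b ^ K = (l ^ K) ^ (Real.log b / Real.log l) := by
        conv_lhs => rw [h1]
        rw [← Real.rpow_mul_natCast hl0.le, mul_comm, Real.rpow_natCast_mul hl0.le]
    _ ≤ _ := Real.rpow_le_rpow (by positivity) hK (div_nonneg (Real.log_nonneg hb) hlog.le)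

/-- Dividing `b` by `l^n` lowers the exponent by exactly `n`, so the surface factor `R^(d-1)`
restores the exponent `α`. -/
lemma rpow_log_div_log_eq {b l R : ℝ} (n : ℕ) (hb : 0 < b) (hl : 1 < l) (hR : 0 < R) :
    R ^ n * R ^ (Real.log (b / l ^ n) / Real.log l) = R ^ (Real.log b / Real.log l) := by
  have hlog : Real.log l ≠ 0 := (Real.log_pos hl).ne'
  rw [Real.log_div hb.ne' (by positivity), Real.log_pow, sub_div, mul_div_cancel_right₀ _ hlog,
    ← Real.rpow_natCast, ← Real.rpow_add hR, add_sub_cancel]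

lemma natCast_add_one_le_mul_log {l R : ℝ} {K : ℕ} (hl : 1 < l) (hK : l ^ K ≤ R) (hR : 2 ≤ R) :
    (K : ℝ) + 1 ≤ (1 / Real.log l + 1 / Real.log 2) * Real.log R := by
  have h2 : 0 < Real.log 2 := Real.log_pos one_lt_two
  have hlog : 0 < Real.log l := Real.log_pos hl
  have h3 : Real.log 2 ≤ Real.log R := Real.log_le_log two_pos hR
  have h4 : K * Real.log l ≤ Real.log R := by
    rw [← Real.log_pow]
    exact Real.log_le_log (by positivity) hK
  rw [add_mul, one_div_mul_eq_div, one_div_mul_eq_div]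
  exact add_le_add ((le_div_iff₀ hlog).2 h4) ((one_le_div h2).2 h3)

/-! ### Supertiles and the bound for `Φ^+`. -/

namespace SelfSimilarTileSubstitution

open Metric

variable {d m : ℕ} (ω : SelfSimilarTileSubstitution d m)

lemma innerMeasure_eq_levelSum (v : ω.Epp) (T : Set (Tile d m))
    (U : Set (EuclideanSpace ℝ (Fin d))) (n : ℕ) :
    ω.innerMeasure v T U n = ω.levelSum v (-(n : ℤ)) (ω.subTiling T n) U := rfl

variable {ω} in
lemma IsTiling.isPacking_subTiling {T : Set (Tile d m)} (hT : ω.IsTiling T) (n : ℕ) :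
    ω.IsPacking (-(n : ℤ)) (ω.subTiling T n) := by
  induction n with
  | zero =>
    intro t ht t' ht' hne
    simp only [Nat.cast_zero, neg_zero, orderSupp_zero]
    exact hT.2 t ht t' ht' hne
  | succ n ih =>
    have := ih.subdivide
    rwa [show (-(n : ℤ) - 1) = -((n + 1 : ℕ) : ℤ) by push_cast; ring] at this

/-- The tiles of order `l` whose `l`-fold subdivision is the patch `ω^n(T_j) - y`. -/
def superPatch (n : ℕ) (j : Fin m) (y : EuclideanSpace ℝ (Fin d)) (l : ℕ) : Set (Tile d m) :=
  {t | ∃ q ∈ ω.iterPatch (n - l) j, t = ⟨q.type, (ω.φ ^ (l : ℤ)) q.pos - y⟩}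

variable (n : ℕ) (j : Fin m) (y : EuclideanSpace ℝ (Fin d))

lemma superPatch_self : ω.superPatch n j y n = {⟨j, -y⟩} := by
  ext t
  simp [superPatch, iterPatch]

lemma mem_superPatch_zero {t : Tile d m} :
    t ∈ ω.superPatch n j y 0 ↔ t.translate y ∈ ω.iterPatch n j := by
  constructor
  · rintro ⟨q, hq, rfl⟩
    simpa [Tile.translate] using hq
  · intro h
    exact ⟨_, h, by simp [Tile.translate]⟩

lemma subdivide_superPatch {l : ℕ} (hl : l < n) :
    ω.subdivide ((l + 1 : ℕ) : ℤ) (ω.superPatch n j y (l + 1)) = ω.superPatch n j y l := by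
  have hit : ω.iterPatch (n - l) j = ω.subst (ω.iterPatch (n - (l + 1)) j) := by
    rw [iterPatch, iterPatch, ← Function.iterate_succ_apply' ω.subst]
    congr 2
    omega
  have hφ : ∀ x, (ω.φ ^ ((l + 1 : ℕ) : ℤ)) x = (ω.φ ^ (l : ℤ)) (ω.φ x) := by
    intro x
    rw [Nat.cast_succ, zpow_add_one, LinearEquiv.mul_apply]
  have hl1 : (((l + 1 : ℕ) : ℤ) - 1) = l := by push_cast; ring
  ext t
  constructor
  · rintro ⟨_, ⟨p, hp, rfl⟩, q, hq, rfl⟩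
    refine ⟨q.translate (ω.φ p.pos), ?_, ?_⟩
    · rw [hit]
      exact ⟨p, hp, q, hq, rfl⟩
    · simp only [Tile.translate, hφ, hl1, map_add, add_sub_assoc]
  · rintro ⟨q', hq', rfl⟩
    rw [hit] at hq'
    obtain ⟨p, hp, q, hq, rfl⟩ := hq'
    refine ⟨_, ⟨p, hp, rfl⟩, q, hq, ?_⟩
    simp only [Tile.translate, hφ, hl1, map_add, add_sub_assoc]

/-- Descend from the single tile at `l = n`; subdivision preserves packings. -/
lemma isPacking_superPatch {l : ℕ} (hl : l ≤ n) :
    ω.IsPacking (l : ℤ) (ω.superPatch n j y l) := by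
  induction hl using Nat.decreasingInduction with
  | self =>
    rw [superPatch_self]
    rintro t rfl t' rfl hne
    exact absurd rfl hne
  | of_succ l hl ih =>
    rw [← ω.subdivide_superPatch n j y hl]
    have := ih.subdivide
    rwa [show (((l + 1 : ℕ) : ℤ) - 1) = l by push_cast; ring] at this

/-- The tiles of `T` meeting `U` form a finite patch, hence lie in a translate of some `ω^n(T_j)`.
This supplies supertiles above the tiles in `U`. -/
lemma exists_superPatch_inter_eq (hd : 1 ≤ d) {T : Set (Tile d m)} (hT : T ∈ ω.tilingSpace)
    {U : Set (EuclideanSpace ℝ (Fin d))} (hU : Bornology.IsBounded U) :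
    ∃ n j y, ∀ t, ω.orderSupp 0 t ⊆ U → (t ∈ T ↔ t ∈ ω.superPatch n j y 0) := by
  have hpack : ω.IsPacking 0 T := by simpa [subTiling] using hT.1.isPacking_subTiling 0
  set P := {t | t ∈ T ∧ (ω.orderSupp 0 t ∩ U).Nonempty} with hP
  obtain ⟨n, j, y, hsub⟩ := hT.2 P (fun t ht => ht.1) (hpack.finite_inter hd hU)
  have hPQ : ∀ t ∈ P, t ∈ ω.superPatch n j y 0 := fun t ht =>
    (ω.mem_superPatch_zero n j y).2 (hsub (Set.mem_image_of_mem _ ht))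
  refine ⟨n, j, y, fun t htU => ⟨fun ht => hPQ t ⟨ht, ?_⟩, fun ht => ?_⟩⟩
  · rw [Set.inter_eq_left.2 htU]
    exact ω.orderSupp_nonempty 0 t
  -- Conversely, `T` covers an interior point of `t` by some `t'`, which meets `U` and so also lies
  -- in the superpatch; the packing property forces `t = t'`.
  · obtain ⟨x, hx⟩ := ω.interior_orderSupp_nonempty 0 t
    have hcov : x ∈ ω.suppSet T := by rw [hT.1.1]; trivial
    obtain ⟨t', ht', hxt'⟩ := Set.mem_iUnion₂.1 hcov
    rw [← orderSupp_zero] at hxt'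
    have ht'P : t' ∈ P := ⟨ht', x, hxt', htU (interior_subset hx)⟩
    have htt' : t = t' := by
      by_contra hne
      have := ω.isPacking_superPatch n j y (Nat.zero_le n) t ht t' (hPQ t' ht'P) hne
      exact Set.disjoint_left.1 (ω.disjoint_interior_orderSupp this) hx hxt'
    rwa [htt']

lemma exists_norm_levelSum_subdivide_sub_le (hd : 1 ≤ d) {Ω : Set (EuclideanSpace ℝ (Fin d))}
    (hΩ : IsLipschitzDomain Ω) :
    ∃ C : ℝ, 0 ≤ C ∧ ∀ (v : ω.Epp) (k : ℤ) (P : Set (Tile d m)), ω.IsPacking k P →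
      ∀ R : ℝ, ω.lam ^ k ≤ R →
      ‖ω.levelSum v (k - 1) (ω.subdivide k P) (R • Ω) - ω.levelSum v k P (R • Ω)‖ ≤
        C * (R / ω.lam ^ k) ^ (d - 1) * ‖ω.stPow (k - 1) v‖ := by
  obtain ⟨D, r, M, hb⟩ := ω.exists_sizeBounds
  obtain ⟨C, hC, hcov⟩ := hΩ.exists_cover_frontier
  refine ⟨M * ⌈((2 * D + 2) / r) ^ d⌉₊ * C, by positivity, fun v k P hP R hR => ?_⟩
  have hk := zpow_pos ω.lam_pos k
  obtain ⟨B, hB, hcard⟩ := hcov R (ω.lam ^ k) hk hR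
  refine (hP.norm_levelSum_subdivide_sub_le hd hb v (hΩ.1.smul₀ (hk.trans_le hR).ne')
    (hΩ.2.1.smul₀ R) hB).trans ?_
  calc _ ≤ M * ⌈((2 * D + 2) / r) ^ d⌉₊ * (C * (R / ω.lam ^ k) ^ (d - 1)) *
        ‖ω.stPow (k - 1) v‖ := by gcongr
    _ = _ := by ring

/-- Take `lam^K₀ ≤ R < lam^(K₀+1)`: by volume, boundedly many tiles of order `K₀` fit in `R • Ω`. If
`n ≤ K₀`, the climb ends at the single tile of order `n`, whence the `max 1`. -/
lemma exists_norm_levelSum_top_le (hd : 1 ≤ d) {Ω : Set (EuclideanSpace ℝ (Fin d))}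
    (hΩ : Bornology.IsBounded Ω) :
    ∃ C : ℝ, 0 ≤ C ∧ ∀ (v : ω.Epp) (R : ℝ), 1 ≤ R → ∃ K₀ : ℕ, ω.lam ^ K₀ ≤ R ∧ ∀ n j y,
      ‖ω.levelSum v (min n K₀ : ℕ) (ω.superPatch n j y (min n K₀)) (R • Ω)‖ ≤
        C * ‖ω.stPow (min n K₀ : ℕ) v‖ := by
  obtain ⟨D, r, M, hb⟩ := ω.exists_sizeBounds
  obtain ⟨B, hB0, hB⟩ := hΩ.subset_ball_lt 0 0
  have hr := hb.r_pos
  have hlam := ω.lam_pos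
  refine ⟨max 1 ((B * ω.lam / r) ^ d), by positivity, fun v R hR => ?_⟩
  obtain ⟨K₀, hK₀, hK₀'⟩ := exists_nat_pow_near hR ω.one_lt_lam
  have hR0 : 0 < R := zero_lt_one.trans_le hR
  refine ⟨K₀, hK₀, fun n j y => norm_levelSum_le v _ fun F hF => ?_⟩
  rcases le_total n K₀ with h | h
  · rw [min_eq_left h, superPatch_self] at hF
    refine le_max_of_le_left ?_
    have : F.card ≤ 1 := Finset.card_le_one.2 fun a ha b hb => by rw [(hF a ha).1, (hF b hb).1]
    exact_mod_cast this
  · rw [min_eq_right h] at hF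
    refine le_max_of_le_right ?_
    refine ((ω.isPacking_superPatch n j y h).card_le hd hb (L := R * B) (by positivity) 0 F
      (fun t ht => (hF t ht).1) fun t ht => (hF t ht).2.trans ?_).trans ?_
    · rintro _ ⟨x, hx, rfl⟩
      have := hB hx
      rw [mem_ball_zero_iff] at this ⊢
      change ‖R • x‖ < _
      rw [norm_smul, Real.norm_of_nonneg hR0.le]
      gcongr
    · have h1 : R * B / (r * ω.lam ^ (K₀ : ℤ)) ≤ B * ω.lam / r := by
        rw [zpow_natCast, div_le_div_iff₀ (by positivity) hr]
        have : R * (B * r) ≤ ω.lam ^ (K₀ + 1) * (B * r) := by gcongr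
        rw [pow_succ] at this
        linarith
      gcongr

/-- The contribution of the tiles of order `0`, estimated through tiles of order up to
`log R / log lam`. -/
lemma exists_norm_innerMeasure_zero_le (hd : 1 ≤ d) {Ω : Set (EuclideanSpace ℝ (Fin d))}
    (hΩ : IsLipschitzDomain Ω) {θ : ℂ} (hθ : ω.lam ^ (d - 1) < ‖θ‖) (s : ℕ) :
    ∃ C : ℝ, 0 ≤ C ∧ ∀ v : ω.Epp,
      ((ω.St - algebraMap ℂ _ θ) ^ s) (v : EuclideanSpace ℂ (Fin m)) = 0 → ‖v‖ = 1 →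
      ∀ T ∈ ω.tilingSpace, ∀ R : ℝ, 2 ≤ R → ‖ω.innerMeasure v T (R • Ω) 0‖ ≤
        C * Real.log R ^ (s - 1) * R ^ (Real.log ‖θ‖ / Real.log ω.lam) := by
  have hc1 : 1 ≤ ω.lam ^ (d - 1) := one_le_pow₀ ω.one_lt_lam.le
  have hc0 : 0 < ω.lam ^ (d - 1) := zero_lt_one.trans_le hc1
  have hθ0 : 0 < ‖θ‖ := hc0.trans hθ
  obtain ⟨C₁, hC₁, hpow⟩ := ω.exists_norm_stPow_le (norm_pos_iff.1 hθ0) s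
  obtain ⟨C₂, hC₂, hstep⟩ := ω.exists_norm_levelSum_subdivide_sub_le hd hΩ
  obtain ⟨C₃, hC₃, htop⟩ := ω.exists_norm_levelSum_top_le hd hΩ.2.1
  set β := ‖θ‖ / ω.lam ^ (d - 1) with hβ
  have hβ1 : 1 < β := (one_lt_div hc0).2 hθ
  set A := 1 / Real.log ω.lam + 1 / Real.log 2 with hA
  have hA0 : 0 ≤ A := add_nonneg (one_div_nonneg.2 (Real.log_nonneg ω.one_lt_lam.le))
    (one_div_nonneg.2 (Real.log_nonneg one_le_two))
  have hβ1' : 0 < β - 1 := sub_pos.2 hβ1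
  refine ⟨(C₃ * C₁ + C₂ * C₁ / (β - 1)) * A ^ (s - 1), by positivity,
    fun v hv hv1 T hT R hR => ?_⟩
  set α := Real.log ‖θ‖ / Real.log ω.lam with hα
  have hR0 : 0 < R := by linarith
  obtain ⟨n, j, y, hpatch⟩ := ω.exists_superPatch_inter_eq hd hT (hΩ.2.1.smul₀ R)
  obtain ⟨K₀, hK₀, hK₀top⟩ := htop v R (by linarith)
  replace hK₀top := hK₀top n j y
  set K := min n K₀ with hKdef
  have hKR : ω.lam ^ K ≤ R :=
    (pow_le_pow_right₀ ω.one_lt_lam.le (min_le_right n K₀)).trans hK₀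
  set a : ℕ → ℂ := fun l => ω.levelSum v l (ω.superPatch n j y l) (R • Ω) with ha
  have ha0 : ω.innerMeasure v T (R • Ω) 0 = a 0 := by
    have hset : {t | t ∈ T ∧ ω.orderSupp 0 t ⊆ R • Ω} =
        {t | t ∈ ω.superPatch n j y 0 ∧ ω.orderSupp 0 t ⊆ R • Ω} :=
      Set.ext fun t => and_congr_left fun h => hpatch t h
    simp only [ha, innerMeasure_eq_levelSum, levelSum, Nat.cast_zero, neg_zero, subTiling, hset]
  have hvn : ∀ l : ℕ, ‖ω.stPow l v‖ ≤ C₁ * ((l : ℝ) + 1) ^ (s - 1) * ‖θ‖ ^ l := fun l => by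
    simpa [hv1] using (hpow v hv l).1
  -- Replacing `(l + 1)^(s-1)` by `(K + 1)^(s-1)` leaves a pure geometric progression of ratio `β >
  -- 1`, whose sum is at most `β^K / (β - 1)`.
  have hdiff : ∀ l ∈ Finset.range K, ‖a l - a (l + 1)‖ ≤
      C₂ * C₁ * ((K : ℝ) + 1) ^ (s - 1) * R ^ (d - 1) * β ^ l := by
    intro l hl
    have hlK : l < K := Finset.mem_range.1 hl
    have hln : l < n := hlK.trans_le (min_le_left _ _)
    have h1 := hstep v ((l + 1 : ℕ) : ℤ) _ (ω.isPacking_superPatch n j y hln) R (by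
      rw [zpow_natCast]
      exact (pow_le_pow_right₀ ω.one_lt_lam.le hlK).trans hKR)
    rw [ω.subdivide_superPatch n j y hln,
      show (((l + 1 : ℕ) : ℤ) - 1) = l by push_cast; ring, zpow_natCast] at h1
    have hlam : 0 < ω.lam := ω.lam_pos
    calc ‖a l - a (l + 1)‖
        ≤ C₂ * (R / ω.lam ^ (l + 1)) ^ (d - 1) * ‖ω.stPow l v‖ := h1
      _ ≤ C₂ * (R / ω.lam ^ l) ^ (d - 1) * (C₁ * ((K : ℝ) + 1) ^ (s - 1) * ‖θ‖ ^ l) := by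
          refine mul_le_mul ?_ ((hvn l).trans ?_) (norm_nonneg _) (by positivity)
          · gcongr
            · exact ω.one_lt_lam.le
            · exact l.le_succ
          · gcongr
      _ = _ := by
          rw [hβ, div_pow, div_pow, ← pow_mul, ← pow_mul, mul_comm l]; ring
  have hsum : ‖a 0 - a K‖ ≤
      C₂ * C₁ * ((K : ℝ) + 1) ^ (s - 1) * R ^ (d - 1) * (β ^ K / (β - 1)) := by
    rw [← Finset.sum_range_sub' a K]
    refine (norm_sum_le_of_le _ hdiff).trans ?_
    rw [← Finset.mul_sum, geom_sum_eq hβ1.ne']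
    gcongr
    linarith
  have htopK : ‖a K‖ ≤ C₃ * (C₁ * ((K : ℝ) + 1) ^ (s - 1) * ‖θ‖ ^ K) :=
    hK₀top.trans (mul_le_mul_of_nonneg_left (hvn K) hC₃)
  have hθK : ‖θ‖ ^ K ≤ R ^ α :=
    pow_le_rpow_log_div_log (hc1.trans hθ.le) ω.one_lt_lam hKR
  have hβK : R ^ (d - 1) * β ^ K ≤ R ^ α := by
    rw [hα, ← rpow_log_div_log_eq (d - 1) hθ0 ω.one_lt_lam hR0]
    gcongr
    exact pow_le_rpow_log_div_log hβ1.le ω.one_lt_lam hKR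
  -- The power of `log R` comes from here: `K + 1` is at most a multiple of `log R`, the summand `1`
  -- being absorbed because `R ≥ 2`.
  have hKlog : ((K : ℝ) + 1) ^ (s - 1) ≤ A ^ (s - 1) * Real.log R ^ (s - 1) := by
    rw [← mul_pow]
    gcongr
    exact natCast_add_one_le_mul_log ω.one_lt_lam hKR hR
  have hlogR : 0 ≤ Real.log R := Real.log_nonneg (by linarith)
  rw [ha0]
  calc ‖a 0‖ ≤ ‖a K‖ + ‖a 0 - a K‖ := by
        simpa using norm_add_le (a K) (a 0 - a K)
    _ ≤ C₃ * (C₁ * ((K : ℝ) + 1) ^ (s - 1) * ‖θ‖ ^ K) +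
        C₂ * C₁ * ((K : ℝ) + 1) ^ (s - 1) * R ^ (d - 1) * (β ^ K / (β - 1)) :=
      add_le_add htopK hsum
    _ = ((K : ℝ) + 1) ^ (s - 1) * (C₃ * C₁ * ‖θ‖ ^ K +
        C₂ * C₁ / (β - 1) * (R ^ (d - 1) * β ^ K)) := by ring
    _ ≤ (A ^ (s - 1) * Real.log R ^ (s - 1)) *
        (C₃ * C₁ * R ^ α + C₂ * C₁ / (β - 1) * R ^ α) := by gcongr
    _ = _ := by ring

/-- The limit defining `Φ^+` exists, and its distance to the term of order `0` is of the order of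
the surface `R^(d-1)`. -/
lemma exists_tendsto_innerMeasure (hd : 1 ≤ d) {Ω : Set (EuclideanSpace ℝ (Fin d))}
    (hΩ : IsLipschitzDomain Ω) {θ : ℂ} (hθ : ω.lam ^ (d - 1) < ‖θ‖) (s : ℕ) :
    ∃ C : ℝ, 0 ≤ C ∧ ∀ v : ω.Epp,
      ((ω.St - algebraMap ℂ _ θ) ^ s) (v : EuclideanSpace ℂ (Fin m)) = 0 → ‖v‖ = 1 →
      ∀ T ∈ ω.tilingSpace, ∀ R : ℝ, 1 ≤ R →
        Tendsto (ω.innerMeasure v T (R • Ω)) atTop (𝓝 (ω.Phi v T (R • Ω))) ∧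
        dist (ω.innerMeasure v T (R • Ω) 0) (ω.Phi v T (R • Ω)) ≤ C * R ^ (d - 1) := by
  have hlam : 0 < ω.lam := ω.lam_pos
  have hc0 : 0 < ω.lam ^ (d - 1) := pow_pos hlam _
  have hθ0 : 0 < ‖θ‖ := hc0.trans hθ
  obtain ⟨C₁, hC₁, hpow⟩ := ω.exists_norm_stPow_le (norm_pos_iff.1 hθ0) s
  obtain ⟨C₂, hC₂, hstep⟩ := ω.exists_norm_levelSum_subdivide_sub_le hd hΩ
  set q := ω.lam ^ (d - 1) / ‖θ‖ with hq
  have hq0 : 0 < q := div_pos hc0 hθ0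
  have hq1 : q < 1 := (div_lt_one hθ0).2 hθ
  -- The step from order `-n` to `-(n + 1)` uses the decay bound at `n + 1`, hence `n + 2` and the
  -- extra `‖θ‖⁻¹`.
  set z : ℕ → ℝ := fun n => ((n : ℝ) + 2) ^ (s - 1) * (‖θ‖⁻¹ * q ^ n) with hz
  have hzs : Summable z := by
    have h0 : Summable fun n : ℕ => (n : ℝ) ^ (s - 1) * q ^ n :=
      summable_pow_mul_geometric_of_norm_lt_one (s - 1) (by rwa [Real.norm_of_nonneg hq0.le])
    have h1 := (summable_nat_add_iff (f := fun n : ℕ => (n : ℝ) ^ (s - 1) * q ^ n) 2).2 h0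
    refine (h1.mul_left (‖θ‖⁻¹ / q ^ 2)).congr fun n => ?_
    simp only [hz]
    push_cast
    rw [pow_add]
    field_simp
  have hz0 : ∀ n, 0 ≤ z n := fun n =>
    mul_nonneg (by positivity) (mul_nonneg (inv_nonneg.2 hθ0.le) (pow_nonneg hq0.le n))
  refine ⟨C₂ * C₁ * ∑' n, z n, mul_nonneg (by positivity) (tsum_nonneg hz0),
    fun v hv hv1 T hT R hR => ?_⟩
  have hR0 : 0 < R := by linarith
  set b : ℕ → ℝ := fun n => C₂ * C₁ * R ^ (d - 1) * z n with hb
  have hbs : Summable b := hzs.mul_left _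
  have hdist : ∀ n, dist (ω.innerMeasure v T (R • Ω) n) (ω.innerMeasure v T (R • Ω) n.succ) ≤
      b n := by
    intro n
    have hRn : ω.lam ^ (-(n : ℤ)) ≤ R := by
      rw [zpow_neg, zpow_natCast]
      exact (inv_le_one_of_one_le₀ (one_le_pow₀ ω.one_lt_lam.le)).trans hR
    have h1 := hstep v (-(n : ℤ)) _ (hT.1.isPacking_subTiling n) R hRn
    have hn : (-(n : ℤ) - 1) = -((n + 1 : ℕ) : ℤ) := by push_cast; ring
    have h2 := (hpow v hv (n + 1)).2
    rw [hn] at h1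
    rw [hv1, mul_one] at h2
    rw [dist_comm, dist_eq_norm]
    refine h1.trans ((mul_le_mul_of_nonneg_left h2 (by positivity)).trans_eq ?_)
    simp only [hb, hz, hq]
    rw [zpow_neg, zpow_natCast, div_inv_eq_mul, mul_pow, div_pow, ← pow_mul, ← pow_mul,
      mul_comm n (d - 1), inv_pow, pow_succ]
    push_cast
    field_simp
    ring
  obtain ⟨x, hx⟩ := cauchySeq_tendsto_of_complete (cauchySeq_of_dist_le_of_summable b hdist hbs)
  have hlim : Tendsto (ω.innerMeasure v T (R • Ω)) atTop (𝓝 (ω.Phi v T (R • Ω))) :=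
    tendsto_nhds_limUnder ⟨x, hx⟩
  refine ⟨hlim, (dist_le_tsum_of_dist_le_of_tendsto₀ b hdist hbs hlim).trans_eq ?_⟩
  rw [hb, tsum_mul_left]
  ring

/-- The distance `O(R^(d-1))` to the sum of order `0` is absorbed, since `α ≥ d - 1` and `log R ≥
log 2`. -/
lemma exists_norm_Phi_le (hd : 1 ≤ d) {Ω : Set (EuclideanSpace ℝ (Fin d))}
    (hΩ : IsLipschitzDomain Ω) {θ : ℂ} (hθ : ω.lam ^ (d - 1) < ‖θ‖) (s : ℕ) :
    ∃ C : ℝ, 0 ≤ C ∧ ∀ v : ω.Epp,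
      ((ω.St - algebraMap ℂ _ θ) ^ s) (v : EuclideanSpace ℂ (Fin m)) = 0 → ‖v‖ = 1 →
      ∀ T ∈ ω.tilingSpace, ∀ R : ℝ, 2 ≤ R →
        Tendsto (ω.innerMeasure v T (R • Ω)) atTop (𝓝 (ω.Phi v T (R • Ω))) ∧
        ‖ω.Phi v T (R • Ω)‖ ≤
          C * Real.log R ^ (s - 1) * R ^ (Real.log ‖θ‖ / Real.log ω.lam) := by
  obtain ⟨C₁, hC₁, h₁⟩ := ω.exists_norm_innerMeasure_zero_le hd hΩ hθ s
  obtain ⟨C₂, hC₂, h₂⟩ := ω.exists_tendsto_innerMeasure hd hΩ hθ s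
  have hc0 : 0 < ω.lam ^ (d - 1) := pow_pos ω.lam_pos _
  have hlog2 : 0 < Real.log 2 := Real.log_pos one_lt_two
  refine ⟨C₁ + C₂ / Real.log 2 ^ (s - 1), by positivity, fun v hv hv1 T hT R hR => ?_⟩
  obtain ⟨hlim, hdist⟩ := h₂ v hv hv1 T hT R (by linarith)
  refine ⟨hlim, ?_⟩
  have hR0 : 0 < R := by linarith
  set α := Real.log ‖θ‖ / Real.log ω.lam with hα
  have hRα : R ^ (d - 1) ≤ R ^ α := by
    rw [hα, ← rpow_log_div_log_eq (d - 1) (hc0.trans hθ) ω.one_lt_lam hR0]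
    refine le_mul_of_one_le_right (by positivity) (Real.one_le_rpow (by linarith) ?_)
    exact div_nonneg (Real.log_nonneg ((one_le_div hc0).2 hθ.le))
      (Real.log_nonneg ω.one_lt_lam.le)
  have hlogR : 1 ≤ Real.log R ^ (s - 1) / Real.log 2 ^ (s - 1) := by
    rw [one_le_div (by positivity)]
    gcongr
  rw [dist_eq_norm] at hdist
  calc ‖ω.Phi v T (R • Ω)‖
      ≤ ‖ω.innerMeasure v T (R • Ω) 0‖ +
        ‖ω.innerMeasure v T (R • Ω) 0 - ω.Phi v T (R • Ω)‖ := norm_le_norm_add_norm_sub _ _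
    _ ≤ C₁ * Real.log R ^ (s - 1) * R ^ α + C₂ * R ^ α * 1 :=
        add_le_add (h₁ v hv hv1 T hT R hR) (hdist.trans (by rw [mul_one]; gcongr))
    _ ≤ C₁ * Real.log R ^ (s - 1) * R ^ α +
        C₂ * R ^ α * (Real.log R ^ (s - 1) / Real.log 2 ^ (s - 1)) := by gcongr
    _ = _ := by ring

end SelfSimilarTileSubstitution

theorem lemma3p3 {d m : ℕ} (hd : 1 ≤ d) (ω : SelfSimilarTileSubstitution d m)
    (hprim : ω.IsPrimitive) (hflc : ω.HasFLC) (hnp : ω.IsNonPeriodic)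
    (Ω : Set (EuclideanSpace ℝ (Fin d))) (hΩ : IsLipschitzDomain Ω) :
    ∃ C : ℝ, 0 < C ∧
      ∀ (θ : ℂ) (s : ℕ) (W : Submodule ℂ (EuclideanSpace ℂ (Fin m))),
        IsJordanBlockSubspace ω.St θ s W →
      ∀ v : ω.Epp, (v : EuclideanSpace ℂ (Fin m)) ∈ W → ‖v‖ = 1 →
      ∀ T ∈ ω.tilingSpace, ∀ R : ℝ, 2 ≤ R →
        Tendsto (ω.innerMeasure v T (R • Ω)) atTop (𝓝 (ω.Phi v T (R • Ω))) ∧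
        ‖ω.Phi v T (R • Ω)‖ ≤
          C * Real.log R ^ (s - 1) * R ^ (Real.log ‖θ‖ / Real.log ω.lam) := by
  classical
  -- The condition on `θ` sits inside the existential so that a constant can be chosen for every
  -- pair `(θ, s)`.
  have hex : ∀ (θ : ℂ) (s : ℕ), ∃ C : ℝ, 0 ≤ C ∧ (ω.lam ^ (d - 1) < ‖θ‖ → ∀ v : ω.Epp,
      ((ω.St - algebraMap ℂ _ θ) ^ s) (v : EuclideanSpace ℂ (Fin m)) = 0 → ‖v‖ = 1 →
      ∀ T ∈ ω.tilingSpace, ∀ R : ℝ, 2 ≤ R →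
        Tendsto (ω.innerMeasure v T (R • Ω)) atTop (𝓝 (ω.Phi v T (R • Ω))) ∧
        ‖ω.Phi v T (R • Ω)‖ ≤
          C * Real.log R ^ (s - 1) * R ^ (Real.log ‖θ‖ / Real.log ω.lam)) := by
    intro θ s
    by_cases hθ : ω.lam ^ (d - 1) < ‖θ‖
    · obtain ⟨C, hC, h⟩ := ω.exists_norm_Phi_le hd hΩ hθ s
      exact ⟨C, hC, fun _ => h⟩
    · exact ⟨0, le_rfl, fun h => absurd h hθ⟩
  choose c hc0 hc using hex
  -- Only finitely many pairs occur: `θ` is an eigenvalue and `s ≤ m`. Summing their constants gives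
  -- one independent of the block; the `+ 1` makes it positive.
  set E := (Module.End.finite_hasEigenvalue ω.St).toFinset ×ˢ Finset.range (m + 1) with hE
  refine ⟨∑ p ∈ E, c p.1 p.2 + 1,
    add_pos_of_nonneg_of_pos (Finset.sum_nonneg fun p _ => hc0 _ _) one_pos, ?_⟩
  intro θ s W hW v hvW hv1 T hT R hR
  have hker := hW.pow_sub_apply_eq_zero hvW
  have hv0 : (v : EuclideanSpace ℂ (Fin m)) ≠ 0 := by
    intro h0
    rw [ZeroMemClass.coe_eq_zero.1 h0, norm_zero] at hv1
    exact zero_ne_one hv1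
  obtain ⟨hlim, hbound⟩ := hc θ s (lt_norm_of_mem_rapidSubspace v.2 hv0 hker) v hker hv1 T hT R hR
  refine ⟨hlim, hbound.trans ?_⟩
  have hmem : (θ, s) ∈ E := by
    rw [hE, Finset.mem_product, Set.Finite.mem_toFinset, Finset.mem_range, Nat.lt_succ_iff]
    exact ⟨hasEigenvalue_of_pow_sub_apply_eq_zero hv0 hker, by simpa using hW.size_le⟩
  have hle : c θ s ≤ ∑ p ∈ E, c p.1 p.2 + 1 :=
    (Finset.single_le_sum (f := fun p : ℂ × ℕ => c p.1 p.2) (fun p _ => hc0 _ _) hmem).trans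
      (le_add_of_nonneg_right zero_le_one)
  have hlog : 0 ≤ Real.log R := Real.log_nonneg (by linarith)
  gcongr
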